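/- Let $N,d\ge 1$ be integers, let $V_0,\dots,V_d\in C_b^\infty(\mathbb R^N;\mathbb R^N)$ (smooth maps that are bounded together with all their derivatives), regarded as vector fields acting on functions by $Vf=\sum_j V^j\,\partial f/\partial x_j$, and put $\|V\|_{C^n}=\sum_{i=0}^n\sup_x\|V^{(i)}(x)\|$, where $V^{(i)}$ is the $i$-th total differential with its operator norm. For $W\in C_b^\infty(\mathbb R^N;\mathbb R^N)$ let $\exp(W)(x)$ be the value at time $1$ of the solution of $dz_t/dt=W(z_t)$, $z_0=x$. A map $g$ from $C_b^\infty(\mathbb R^N;\mathbb R^N)$ to the set of all maps $\mathbb R^N\to\mathbb R^N$ is an integration scheme of order $m$, $g\in\mathcal{IS}(m)$, if there is a constant $C>0$ such that $\sup_x|g(W)(x)-\exp(W)(x)|\le C\|W\|_{C^{m+1}}^{m+1}$ for all $W\in C_b^\infty(\mathbb R^N;\mathbb R^N)$. Let $A=\{v_0,\dots,v_d\}$ be an alphabet, $A^*$ the set of words, and for $w=v_{i_1}\cdots v_{i_n}$ put $\|w\|=n+\#\{k: i_k=0\}$. On the algebra $\mathbb R\langle\langle A\rangle\rangle$ of non-commutative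 formal series $P=\sum_w (P,w)w$, with the product topology and its Borel $\sigma$-algebra, let $j_m P=\sum_{\|w\|\le m}(P,w)w$ and $\Psi_sP=\sum_w s^{\|w\|/2}(P,w)w$; for polynomials $P$ let $\|P\|_2=(\sum_w (P,w)^2)^{1/2}$. Lie polynomials form the smallest linear subspace that contains $A$ and is closed under $[P,Q]=PQ-QP$; Lie series, forming the set $\mathcal L_{\mathbb R}((A))$, are the series all of whose homogeneous components (with respect to $\|\cdot\|$) are Lie polynomials. With $\exp(P)=\sum_{k\ge0}P^k/k!$ when $(P,1)=0$ and $\log(Q)=\sum_{k\ge1}(-1)^{k-1}(Q-1)^k/k$ when $(Q,1)=1$, put $z_1\vdash\!\dashv\cdots\vdash\!\dashv z_n=\log(\exp(z_1)\cdots\exp(z_n))$ for Lie series $z_1,\dots,z_n$. Let $\Phi$ be the algebra homomorphism from non-commutative polynomials to differential operators on $\mathbb R^N$ with $\Phi(1)=\mathrm{Id}$ and $\Phi(v_i)=V_i$; it maps Lie polynomials to vector fields in $C_b^\infty(\mathbb R^N;\mathbb R^N)$. Put $\Phi_s=\Phi\circ\Psi_s$. **Theorem.** Let $m\ge1$, $M\ge2$,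 and let $Z_1,\dots,Z_M$ be $\mathcal L_{\mathbb R}((A))$-valued random variables on a probability space such that $Z_i=j_mZ_i$ and $E[\|j_mZ_i\|_2]<\infty$ for $i=1,\dots,M$, and $$E\Big[\exp\Big(a\sum_{j=1}^M\|\Phi_s(Z_j)\|_{C^{m+1}}\Big)\Big]<\infty\quad\text{for all } s\in(0,1] \text{ and all } a>0 .$$ Then for every $p\in[1,\infty)$ and all $g_1,\dots,g_M\in\mathcal{IS}(m)$ there is a constant $C>0$, independent of $s$, such that for all $s\in(0,1]$ $$\Big\|\sup_{x\in\mathbb R^N}\Big|g_1(\Phi_s(Z_1))\circ\cdots\circ g_M(\Phi_s(Z_M))(x)-\exp\big(\Phi_s(j_m(Z_M\vdash\!\dashv\cdots\vdash\!\dashv Z_1))\big)(x)\Big|\Big\|_{L^p}\le C\,s^{(m+1)/2}.$$ Here the $L^p$ norm of a possibly non-measurable non-negative function is the infimum of the $L^p$ norms of its measurable majorants. -/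

import Mathlib

open MeasureTheory
open scoped ENNReal

namespace KRK

noncomputable section

/-! ### Non-commutative formal series -/

/-- The alphabet `{v_0, …, v_d}` is `Fin (d + 1)`; words are lists of letters. -/
abbrev Word (d : ℕ) : Type := List (Fin (d + 1))

/-- `ℝ⟪A⟫`: formal series, as families of coefficients `P w = (P, w)`. As a type of functions it
carries the product topology and the product (Borel) σ-algebra. -/
abbrev Series (d : ℕ) : Type := Word d → ℝ

/-- The weight `‖w‖ = |w| + card {k | i_k = 0}` of a word. -/
def weight {d : ℕ} (w : Word d) : ℕ := w.length + w.count 0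

/-- The letter `v_i` as a series. -/
def letter {d : ℕ} (i : Fin (d + 1)) : Series d := fun w => if w = [i] then 1 else 0

/-- The unit of `ℝ⟪A⟫` (the empty word). -/
def sOne (d : ℕ) : Series d := fun w => if w = [] then 1 else 0

/-- The product of series: `(PQ, w) = ∑_{w = uv} (P, u) (Q, v)`. -/
def sMul {d : ℕ} (P Q : Series d) : Series d :=
  fun w => ∑ k ∈ Finset.range (w.length + 1), P (w.take k) * Q (w.drop k)

/-- Powers of a series. -/
def sPow {d : ℕ} (P : Series d) : ℕ → Series d
  | 0 => sOne d
  | k + 1 => sMul P (sPow P k)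

/-- `[P, Q] = PQ - QP`. -/
def sBracket {d : ℕ} (P Q : Series d) : Series d := sMul P Q - sMul Q P

/-- `exp P = 1 + ∑_{k ≥ 1} P^k / k!` for `(P, 1) = 0`; in that case `(P^k, w) = 0` for `k > |w|`, so
that the sum may be stopped at `k = |w|` in the coefficient of `w`. -/
def sExp {d : ℕ} (P : Series d) : Series d :=
  fun w => ∑ k ∈ Finset.range (w.length + 1), sPow P k w / (k.factorial : ℝ)

/-- `log Q = ∑_{k ≥ 1} (-1)^(k-1) (Q - 1)^k / k` for `(Q, 1) = 1`; again only `k ≤ |w|` contribute to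
the coefficient of `w`. -/
def sLog {d : ℕ} (Q : Series d) : Series d :=
  fun w => ∑ k ∈ Finset.Icc 1 w.length, (-1 : ℝ) ^ (k - 1) * sPow (Q - sOne d) k w / (k : ℝ)

/-- The iterated Baker–Campbell–Hausdorff product
`z_1 ⊢⊣ … ⊢⊣ z_n = log (exp z_1 ⋯ exp z_n)` of a list `[z_1, …, z_n]`. -/
def bch {d : ℕ} (l : List (Series d)) : Series d :=
  sLog ((l.map sExp).foldr sMul (sOne d))

/-- The truncation `j_m`. -/
def trunc {d : ℕ} (m : ℕ) (P : Series d) : Series d := fun w => if weight w ≤ m then P w else 0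

/-- The component of weight `k`. -/
def component {d : ℕ} (k : ℕ) (P : Series d) : Series d := fun w => if weight w = k then P w else 0

/-- The rescaling `Ψ_s`: multiplication of the component of weight `k` by `s^(k/2)`. -/
def rescale {d : ℕ} (s : ℝ) (P : Series d) : Series d :=
  fun w => s ^ ((weight w : ℝ) / 2) * P w

/-- `‖P‖₂` of a non-commutative polynomial. -/
def l2Norm {d : ℕ} (P : Series d) : ℝ := Real.sqrt (∑' w, P w ^ 2)

/-- Lie polynomials: the smallest submodule containing the letters and closed under the bracket. -/
inductive IsLiePolynomial {d : ℕ} : Series d → Prop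
  | letter (i : Fin (d + 1)) : IsLiePolynomial (KRK.letter i)
  | zero : IsLiePolynomial 0
  | add {P Q : Series d} : IsLiePolynomial P → IsLiePolynomial Q → IsLiePolynomial (P + Q)
  | smul (c : ℝ) {P : Series d} : IsLiePolynomial P → IsLiePolynomial (c • P)
  | bracket {P Q : Series d} :
      IsLiePolynomial P → IsLiePolynomial Q → IsLiePolynomial (sBracket P Q)

/-- Lie series: all homogeneous components are Lie polynomials. -/
def IsLieSeries {d : ℕ} (P : Series d) : Prop := ∀ k : ℕ, IsLiePolynomial (component k P)

/-! ### Vector fields on `ℝ^N` -/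

/-- `C_b^∞(ℝ^N; ℝ^N)`: smooth, bounded together with all derivatives. -/
def IsCbSmooth {N : ℕ} (W : EuclideanSpace ℝ (Fin N) → EuclideanSpace ℝ (Fin N)) : Prop :=
  ContDiff ℝ ((⊤ : ℕ∞) : WithTop ℕ∞) W ∧ ∀ n : ℕ, ∃ K : ℝ, ∀ x, ‖iteratedFDeriv ℝ n W x‖ ≤ K

/-- `‖W‖_{C^n} = ∑_{i ≤ n} sup_x ‖W^{(i)}(x)‖`, with the operator norm of multilinear maps
(the supremum over unit vectors). Meant for `W` in `C_b^∞`, where the suprema are finite. -/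
def cNorm {N : ℕ} (n : ℕ) (W : EuclideanSpace ℝ (Fin N) → EuclideanSpace ℝ (Fin N)) : ℝ :=
  ∑ i ∈ Finset.range (n + 1), ⨆ x, ‖iteratedFDeriv ℝ i W x‖

/-- A vector field `U` acting on functions: `(U f)(x) = ∑_j U^j(x) ∂f/∂x_j (x)`, also on
vector-valued functions, component by component. -/
def derivAlong {N : ℕ} {F : Type*} [NormedAddCommGroup F] [NormedSpace ℝ F]
    (U : EuclideanSpace ℝ (Fin N) → EuclideanSpace ℝ (Fin N))
    (f : EuclideanSpace ℝ (Fin N) → F) : EuclideanSpace ℝ (Fin N) → F :=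
  fun x => fderiv ℝ f x (U x)

/-- `Φ(v_{i_1} ⋯ v_{i_n}) f = V_{i_1} (V_{i_2} (⋯ (V_{i_n} f)))`. -/
def wordOp {N d : ℕ} {F : Type*} [NormedAddCommGroup F] [NormedSpace ℝ F]
    (V : Fin (d + 1) → EuclideanSpace ℝ (Fin N) → EuclideanSpace ℝ (Fin N))
    (w : Word d) (f : EuclideanSpace ℝ (Fin N) → F) : EuclideanSpace ℝ (Fin N) → F :=
  w.foldr (fun i h => derivAlong (V i) h) f

/-- The differential operator `Φ(P) = ∑_w (P, w) Φ(w)` of a non-commutative polynomial `P`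
(a series with finitely many non-zero coefficients). -/
def phiOp {N d : ℕ} {F : Type*} [NormedAddCommGroup F] [NormedSpace ℝ F]
    (V : Fin (d + 1) → EuclideanSpace ℝ (Fin N) → EuclideanSpace ℝ (Fin N))
    (P : Series d) (f : EuclideanSpace ℝ (Fin N) → F) : EuclideanSpace ℝ (Fin N) → F :=
  fun x => ∑ᶠ w : Word d, P w • wordOp V w f x

/-- For a Lie polynomial `P` the operator `Φ(P)` is a vector field, and the `i`-th component of a
vector field is its value on the coordinate function `x ↦ x_i`: as a function `ℝ^N → ℝ^N`, the
vector field is the operator applied to the identity map. -/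
def phiField {N d : ℕ}
    (V : Fin (d + 1) → EuclideanSpace ℝ (Fin N) → EuclideanSpace ℝ (Fin N))
    (P : Series d) : EuclideanSpace ℝ (Fin N) → EuclideanSpace ℝ (Fin N) :=
  phiOp V P id

/-- `z` solves `dz/dt = W(z)`, `z_0 = x` on `[0, 1]`. -/
def IsSolution {N : ℕ} (W : EuclideanSpace ℝ (Fin N) → EuclideanSpace ℝ (Fin N))
    (x : EuclideanSpace ℝ (Fin N)) (z : ℝ → EuclideanSpace ℝ (Fin N)) : Prop :=
  z 0 = x ∧ ∀ t ∈ Set.Icc (0 : ℝ) 1, HasDerivWithinAt z (W (z t)) (Set.Icc 0 1) t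

open Classical in
/-- `exp(W)(x)`: the value at time `1` of the solution of `dz/dt = W(z)`, `z_0 = x`. For `W` in
`C_b^∞` the solution exists and is unique on `[0, 1]`. -/
def flowExp {N : ℕ} (W : EuclideanSpace ℝ (Fin N) → EuclideanSpace ℝ (Fin N))
    (x : EuclideanSpace ℝ (Fin N)) : EuclideanSpace ℝ (Fin N) :=
  if h : ∃ z, IsSolution W x z then h.choose 1 else x

/-- Integration schemes of order `m`. Only the values of `g` on `C_b^∞` are constrained (and used);
what `g` does to other maps is irrelevant. -/
def IsIntegrationScheme {N : ℕ} (m : ℕ)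
    (g : (EuclideanSpace ℝ (Fin N) → EuclideanSpace ℝ (Fin N)) →
      EuclideanSpace ℝ (Fin N) → EuclideanSpace ℝ (Fin N)) : Prop :=
  ∃ C : ℝ, 0 < C ∧ ∀ W, IsCbSmooth W → ∀ x,
    ‖g W x - flowExp W x‖ ≤ C * cNorm (m + 1) W ^ (m + 1)

/-- The composition `f_1 ∘ f_2 ∘ … ∘ f_M`. -/
def compAll {α : Type*} {M : ℕ} (f : Fin M → α → α) : α → α :=
  (List.ofFn f).foldr (fun h k => h ∘ k) id

/-! ### `L^p` norms -/

/-- The `L^p` norm (in `[0, ∞]`) of a non-negative function, as the infimum of the `L^p` norms of its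
measurable majorants. For measurable functions it is the usual norm; integration schemes are
arbitrary maps, so that the error below need not be measurable. -/
def outerLpNorm {Ω : Type*} [MeasurableSpace Ω] (f : Ω → ℝ≥0∞) (p : ℝ) (μ : Measure Ω) : ℝ≥0∞ :=
  ⨅ (G : Ω → ℝ≥0∞) (_ : Measurable G) (_ : ∀ ω, f ω ≤ G ω), eLpNorm G (ENNReal.ofReal p) μ

end

end KRK

open KRK

/-
The moment assumption controls the fields `Φ_s(Z_j)` and not the coefficients of `Z_j`, since `Φ`
need not be injective. As Lie polynomials of weight at most `m` form a finite-dimensional space,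
finitely many values of the fields `Φ_s(Z_j)` determine all of them, linearly. So each `Z_j` may be
replaced by a Lie polynomial with the same fields whose coefficients are bounded by a random `R`
with moments of all orders. The change lies componentwise in the kernel of `Φ`, which is a
two-sided ideal closed under dilations, and hence does not affect `Φ_s(j_m(Z_M ⊢⊣ ⋯ ⊢⊣ Z_1))`.

The dilation `Ψ` absorbs `R`, and the error is `O((√s R)^(m+1))` uniformly. For `√s R ≤ 1` the
schemes are replaced by flows using Lipschitz bounds, the composition of the flows agrees with
`Φ_s(j_m(exp Z_M ⋯ exp Z_1))` by Taylor expansion (operators compose in the opposite order to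
flows), and the flow of the logarithm has the same expansion. For `√s R > 1` already the distances
of all these points from `x` are `O((√s R)^(m+1))`.

That the logarithm is a Lie series is seen from the derivation `D` multiplying words by their
weight: `D(exp L) exp(-L)` is the image of `D L` under a power series in `ad L`, and this relation
can be solved for the components of `L` by induction on the weight.
-/

namespace KRK

noncomputable section

open Finset.HasAntidiagonal (antidiagonal mem_antidiagonal)

/-! ### The algebra of non-commutative series -/

section Words

variable {d : ℕ}

theorem weight_nil : weight ([] : Word d) = 0 := rfl

theorem weight_append (u v : Word d) : weight (u ++ v) = weight u + weight v := by
  simp only [weight, List.length_append, List.count_append]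
  ring

theorem length_le_weight (w : Word d) : w.length ≤ weight w :=
  Nat.le_add_right _ _

theorem weight_eq_zero_iff {w : Word d} : weight w = 0 ↔ w = [] := by
  refine ⟨fun h => ?_, fun h => h ▸ weight_nil⟩
  exact List.length_eq_zero_iff.mp (Nat.le_zero.mp (h ▸ length_le_weight w))

theorem weight_take_add_weight_drop (w : Word d) (k : ℕ) :
    weight (w.take k) + weight (w.drop k) = weight w := by
  rw [← weight_append, List.take_append_drop]

theorem finite_setOf_weight_le (d n : ℕ) : {w : Word d | weight w ≤ n}.Finite :=
  (List.finite_length_le (Fin (d + 1)) n).subset fun w hw => (length_le_weight w).trans hw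

/-- The finite set of words of weight at most `n`. -/
def wordsLE (d n : ℕ) : Finset (Word d) :=
  (finite_setOf_weight_le d n).toFinset

theorem mem_wordsLE {n : ℕ} {w : Word d} : w ∈ wordsLE d n ↔ weight w ≤ n := by
  simp [wordsLE]

end Words

/-- The algebra `ℝ⟪A⟫`: a copy of `Series d` whose multiplication is `sMul` rather than the
pointwise product of functions. -/
def NCSeries (d : ℕ) : Type := Word d → ℝ

namespace NCSeries

variable {d : ℕ}

instance : AddCommGroup (NCSeries d) := inferInstanceAs (AddCommGroup (Word d → ℝ))
instance : Module ℝ (NCSeries d) := inferInstanceAs (Module ℝ (Word d → ℝ))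
instance : Mul (NCSeries d) := ⟨fun P Q => sMul P Q⟩
instance : One (NCSeries d) := ⟨sOne d⟩

/-- The identification of `Series d` with the algebra `NCSeries d`. -/
def ofSeries (P : Series d) : NCSeries d := P

/-- The coefficient `(P, w)`. -/
def coeff (w : Word d) : NCSeries d →ₗ[ℝ] ℝ where
  toFun P := P w
  map_add' _ _ := rfl
  map_smul' _ _ := rfl

@[ext] theorem ext {P Q : NCSeries d} (h : ∀ w, coeff w P = coeff w Q) : P = Q := funext h

@[simp] theorem coeff_ofSeries (w : Word d) (P : Series d) : coeff w (ofSeries P) = P w := rfl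

theorem coeff_mul (w : Word d) (P Q : NCSeries d) :
    coeff w (P * Q)
      = ∑ k ∈ Finset.range (w.length + 1), coeff (w.take k) P * coeff (w.drop k) Q := rfl

theorem coeff_one (w : Word d) : coeff w (1 : NCSeries d) = if w = [] then 1 else 0 := rfl

/-- The series of the coefficients of the words starting with `a`, for inductions on words. -/
def leftQuotient (a : Fin (d + 1)) (P : NCSeries d) : NCSeries d :=
  ofSeries fun w => coeff (a :: w) P

@[simp] theorem coeff_leftQuotient (a : Fin (d + 1)) (w : Word d) (P : NCSeries d) :
    coeff w (leftQuotient a P) = coeff (a :: w) P := rfl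

theorem coeff_nil_mul (P Q : NCSeries d) : coeff [] (P * Q) = coeff [] P * coeff [] Q := by
  simp [coeff_mul]

theorem coeff_cons_mul (a : Fin (d + 1)) (w : Word d) (P Q : NCSeries d) :
    coeff (a :: w) (P * Q)
      = coeff [] P * coeff (a :: w) Q + coeff w (leftQuotient a P * Q) := by
  rw [coeff_mul, coeff_mul, List.length_cons, Finset.sum_range_succ', add_comm]
  simp

protected theorem add_mul (P Q R : NCSeries d) : (P + Q) * R = P * R + Q * R := by
  ext w; simp [coeff_mul, add_mul, Finset.sum_add_distrib]

protected theorem smul_mul (c : ℝ) (P Q : NCSeries d) : (c • P) * Q = c • (P * Q) := by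
  ext w; simp [coeff_mul, Finset.mul_sum, mul_assoc]

protected theorem mul_assoc (P Q R : NCSeries d) : P * Q * R = P * (Q * R) := by
  ext w
  induction w generalizing P Q with
  | nil => simp only [coeff_nil_mul, mul_assoc]
  | cons a w ih =>
    have leftQuotient_mul :
        leftQuotient a (P * Q) = coeff [] P • leftQuotient a Q + leftQuotient a P * Q := by
      ext v; simp [coeff_cons_mul]
    rw [coeff_cons_mul, coeff_cons_mul, coeff_cons_mul, coeff_nil_mul, leftQuotient_mul,
      NCSeries.add_mul, NCSeries.smul_mul, map_add, map_smul, ih, smul_eq_mul]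
    ring

protected theorem one_mul (P : NCSeries d) : 1 * P = P := by
  ext w
  cases w with
  | nil => simp [coeff_nil_mul, coeff_one]
  | cons a w => simp [coeff_mul, coeff_one]

protected theorem mul_one (P : NCSeries d) : P * 1 = P := by
  ext w
  induction w generalizing P with
  | nil => simp [coeff_nil_mul, coeff_one]
  | cons a w ih => simp [coeff_cons_mul, ih, coeff_one]

instance : Ring (NCSeries d) where
  __ := (inferInstance : AddCommGroup (NCSeries d))
  mul_assoc := NCSeries.mul_assoc
  one_mul := NCSeries.one_mul
  mul_one := NCSeries.mul_one
  left_distrib P Q R := by ext w; simp [coeff_mul, mul_add, Finset.sum_add_distrib]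
  right_distrib := NCSeries.add_mul
  zero_mul P := by ext w; simp [coeff_mul]
  mul_zero P := by ext w; simp [coeff_mul]

instance : Algebra ℝ (NCSeries d) :=
  Algebra.ofModule NCSeries.smul_mul fun c P Q => by
    ext w
    simp only [coeff_mul, map_smul, smul_eq_mul, Finset.mul_sum, mul_left_comm]

theorem sPow_eq_pow (P : NCSeries d) (k : ℕ) : sPow P k = P ^ k := by
  induction k with
  | zero => rfl
  | succ k ih => rw [pow_succ', ← ih]; rfl

/-! ### Filtration and grading by weight -/

/-- The two-sided ideal of the series without terms of weight less than `n`. -/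
def weightGE (d n : ℕ) : Ideal (NCSeries d) where
  carrier := {P | ∀ w, weight w < n → coeff w P = 0}
  add_mem' hP hQ w hw := by rw [map_add, hP w hw, hQ w hw, add_zero]
  zero_mem' w _ := map_zero _
  smul_mem' P Q hQ w hw := by
    refine (coeff_mul w P Q).trans (Finset.sum_eq_zero fun k _ => ?_)
    have := weight_take_add_weight_drop w k
    rw [hQ _ (by omega), mul_zero]

theorem mul_mem_weightGE_add {i j : ℕ} {P Q : NCSeries d} (hP : P ∈ weightGE d i)
    (hQ : Q ∈ weightGE d j) : P * Q ∈ weightGE d (i + j) := by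
  intro w hw
  refine (coeff_mul w P Q).trans (Finset.sum_eq_zero fun k _ => ?_)
  have := weight_take_add_weight_drop w k
  rcases lt_or_ge (weight (w.take k)) i with h | h
  · rw [hP _ h, zero_mul]
  · rw [hQ _ (by omega), mul_zero]

theorem mem_weightGE_zero (P : NCSeries d) : P ∈ weightGE d 0 :=
  fun _ hw => absurd hw (Nat.not_lt_zero _)

instance (n : ℕ) : (weightGE d n).IsTwoSided :=
  ⟨fun Q hP => mul_mem_weightGE_add hP (mem_weightGE_zero Q)⟩

theorem weightGE_antitone : Antitone (weightGE d) :=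
  fun _ _ h _ hP w hw => hP w (hw.trans_le h)

theorem mem_weightGE_one_iff {P : NCSeries d} : P ∈ weightGE d 1 ↔ coeff [] P = 0 := by
  refine ⟨fun h => h [] Nat.zero_lt_one, fun h w hw => ?_⟩
  rw [weight_eq_zero_iff.mp (Nat.lt_one_iff.mp hw), h]

theorem pow_mem_weightGE {P : NCSeries d} (hP : P ∈ weightGE d 1) (k : ℕ) :
    P ^ k ∈ weightGE d k := by
  induction k with
  | zero => exact mem_weightGE_zero _
  | succ k ih => rw [pow_succ]; exact mul_mem_weightGE_add ih hP

theorem smodEq_weightGE_iff {n : ℕ} {P Q : NCSeries d} :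
    P ≡ Q [SMOD weightGE d n] ↔ ∀ w, weight w < n → coeff w P = coeff w Q := by
  rw [SModEq.sub_mem]
  exact forall₂_congr fun w _ => by rw [map_sub, sub_eq_zero]

/-- The polynomials all of whose terms have weight at most `n`. -/
def weightLE (d n : ℕ) : Submodule ℝ (NCSeries d) where
  carrier := {P | ∀ w, n < weight w → coeff w P = 0}
  add_mem' hP hQ w hw := by rw [map_add, hP w hw, hQ w hw, add_zero]
  zero_mem' w _ := map_zero _
  smul_mem' c P hP w hw := by rw [map_smul, hP w hw, smul_zero]

theorem weightLE_mono : Monotone (weightLE d) :=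
  fun _ _ h _ hP w hw => hP w (h.trans_lt hw)

theorem one_mem_weightLE (n : ℕ) : (1 : NCSeries d) ∈ weightLE d n := by
  rintro w hw
  rw [coeff_one, if_neg]
  rintro rfl
  exact absurd hw (Nat.not_lt_zero n)

theorem mul_mem_weightLE_add {i j : ℕ} {P Q : NCSeries d} (hP : P ∈ weightLE d i)
    (hQ : Q ∈ weightLE d j) : P * Q ∈ weightLE d (i + j) := by
  intro w hw
  refine (coeff_mul w P Q).trans (Finset.sum_eq_zero fun k _ => ?_)
  have := weight_take_add_weight_drop w k
  rcases lt_or_ge i (weight (w.take k)) with h | h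
  · rw [hP _ h, zero_mul]
  · rw [hQ _ (by omega), mul_zero]

theorem pow_mem_weightLE {n : ℕ} {P : NCSeries d} (hP : P ∈ weightLE d n) (k : ℕ) :
    P ^ k ∈ weightLE d (k * n) := by
  induction k with
  | zero => exact one_mem_weightLE _
  | succ k ih => rw [pow_succ, Nat.succ_mul]; exact mul_mem_weightLE_add ih hP

/-- Coefficientwise multiplication by a function of the word. -/
def scaleCoeffs (c : Word d → ℝ) : NCSeries d →ₗ[ℝ] NCSeries d where
  toFun P := ofSeries fun w => c w * coeff w P
  map_add' P Q := by ext w; simp [mul_add]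
  map_smul' a P := by ext w; simp [mul_left_comm]

@[simp] theorem coeff_scaleCoeffs (c : Word d → ℝ) (w : Word d) (P : NCSeries d) :
    coeff w (scaleCoeffs c P) = c w * coeff w P := rfl

/-- The truncation `j_m` as a linear map. -/
def truncation (m : ℕ) : NCSeries d →ₗ[ℝ] NCSeries d :=
  scaleCoeffs fun w => if weight w ≤ m then 1 else 0

theorem coeff_truncation (m : ℕ) (w : Word d) (P : NCSeries d) :
    coeff w (truncation m P) = if weight w ≤ m then coeff w P else 0 := by
  simp [truncation]

theorem ofSeries_trunc (m : ℕ) (P : NCSeries d) : ofSeries (trunc m P) = truncation m P := by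
  ext w; rw [coeff_truncation]; rfl

/-- The homogeneous component of weight `k` as a linear map. -/
def homogeneousComponent (k : ℕ) : NCSeries d →ₗ[ℝ] NCSeries d :=
  scaleCoeffs fun w => if weight w = k then 1 else 0

theorem coeff_homogeneousComponent (k : ℕ) (w : Word d) (P : NCSeries d) :
    coeff w (homogeneousComponent k P) = if weight w = k then coeff w P else 0 := by
  simp [homogeneousComponent]

theorem ofSeries_component (k : ℕ) (P : NCSeries d) :
    ofSeries (component k P) = homogeneousComponent k P := by
  ext w; rw [coeff_homogeneousComponent]; rfl

/-- The dilation by `t`, which multiplies the component of weight `k` by `t ^ k`; the rescaling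
`Ψ_s` is the dilation by `√s`. -/
def dilation (t : ℝ) : NCSeries d →ₐ[ℝ] NCSeries d :=
  AlgHom.ofLinearMap (scaleCoeffs fun w => t ^ weight w)
    (by ext w; by_cases hw : w = [] <;> simp [coeff_one, hw, weight_nil])
    (by
      intro P Q
      ext w
      simp only [coeff_scaleCoeffs, coeff_mul, Finset.mul_sum]
      refine Finset.sum_congr rfl fun k _ => ?_
      rw [← weight_take_add_weight_drop w k, pow_add]
      ring)

@[simp] theorem coeff_dilation (t : ℝ) (w : Word d) (P : NCSeries d) :
    coeff w (dilation t P) = t ^ weight w * coeff w P := rfl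

theorem dilation_mem_weightLE {n : ℕ} {P : NCSeries d} (hP : P ∈ weightLE d n) (t : ℝ) :
    dilation t P ∈ weightLE d n :=
  fun w hw => by rw [coeff_dilation, hP w hw, mul_zero]

theorem dilation_mem_weightGE {n : ℕ} {P : NCSeries d} (hP : P ∈ weightGE d n) (t : ℝ) :
    dilation t P ∈ weightGE d n :=
  fun w hw => by rw [coeff_dilation, hP w hw, mul_zero]

theorem dilation_dilation (s t : ℝ) (P : NCSeries d) :
    dilation s (dilation t P) = dilation (s * t) P := by
  ext w; simp only [coeff_dilation, mul_pow, mul_assoc]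

theorem dilation_truncation (t : ℝ) (m : ℕ) (P : NCSeries d) :
    dilation t (truncation m P) = truncation m (dilation t P) := by
  ext w; simp only [coeff_dilation, coeff_truncation, mul_ite, mul_zero]

theorem ofSeries_rescale {s : ℝ} (hs : 0 ≤ s) (P : NCSeries d) :
    ofSeries (rescale s P) = dilation √s P := by
  ext w
  change s ^ ((weight w : ℝ) / 2) * coeff w P = _
  rw [coeff_dilation, Real.sqrt_eq_rpow, ← Real.rpow_natCast, ← Real.rpow_mul hs]
  congr 2; ring

/-- The Euler derivation, which multiplies the component of weight `k` by `k`. -/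
def eulerDeriv : NCSeries d →ₗ[ℝ] NCSeries d :=
  scaleCoeffs fun w => (weight w : ℝ)

@[simp] theorem coeff_eulerDeriv (w : Word d) (P : NCSeries d) :
    coeff w (eulerDeriv P) = weight w * coeff w P := rfl

theorem eulerDeriv_mul (P Q : NCSeries d) :
    eulerDeriv (P * Q) = eulerDeriv P * Q + P * eulerDeriv Q := by
  ext w
  simp only [coeff_eulerDeriv, coeff_mul, map_add, Finset.mul_sum, ← Finset.sum_add_distrib]
  refine Finset.sum_congr rfl fun k _ => ?_
  rw [← weight_take_add_weight_drop w k]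
  push_cast
  ring

theorem eulerDeriv_one : eulerDeriv (1 : NCSeries d) = 0 := by
  simpa using eulerDeriv_mul (1 : NCSeries d) 1

theorem eulerDeriv_mem_weightGE {n : ℕ} {P : NCSeries d} (hP : P ∈ weightGE d n) :
    eulerDeriv P ∈ weightGE d n :=
  fun w hw => by rw [coeff_eulerDeriv, hP w hw, mul_zero]

theorem smodEq_eulerDeriv {n : ℕ} {P Q : NCSeries d} (h : P ≡ Q [SMOD weightGE d n]) :
    eulerDeriv P ≡ eulerDeriv Q [SMOD weightGE d n] := by
  rw [SModEq.sub_mem] at h ⊢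
  rw [← map_sub]
  exact eulerDeriv_mem_weightGE h

theorem truncation_smodEq (n : ℕ) (P : NCSeries d) :
    truncation n P ≡ P [SMOD weightGE d (n + 1)] :=
  smodEq_weightGE_iff.mpr fun w hw => by rw [coeff_truncation, if_pos (Nat.lt_succ_iff.mp hw)]

theorem truncation_mem_weightLE (n : ℕ) (P : NCSeries d) : truncation n P ∈ weightLE d n :=
  fun w hw => by rw [coeff_truncation, if_neg (not_le.mpr hw)]

theorem truncation_eq_self {n : ℕ} {P : NCSeries d} (hP : P ∈ weightLE d n) :
    truncation n P = P := by
  ext w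
  rw [coeff_truncation]
  split_ifs with h
  · rfl
  · rw [hP w (not_le.mp h)]

theorem truncation_eq_truncation_iff {n : ℕ} {P Q : NCSeries d} :
    truncation n P = truncation n Q ↔ P ≡ Q [SMOD weightGE d (n + 1)] := by
  constructor <;> intro h
  · exact (truncation_smodEq n P).symm.trans (h ▸ truncation_smodEq n Q)
  · ext w
    rw [coeff_truncation, coeff_truncation]
    split_ifs with hw
    · exact smodEq_weightGE_iff.mp h w (Nat.lt_succ_iff.mpr hw)
    · rfl

theorem homogeneousComponent_eq_of_smodEq {n k : ℕ} (hk : k < n) {P Q : NCSeries d}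
    (h : P ≡ Q [SMOD weightGE d n]) : homogeneousComponent k P = homogeneousComponent k Q := by
  ext w
  rw [coeff_homogeneousComponent, coeff_homogeneousComponent]
  split_ifs with hw
  · exact smodEq_weightGE_iff.mp h w (hw ▸ hk)
  · rfl

theorem homogeneousComponent_mul (k : ℕ) (P Q : NCSeries d) :
    homogeneousComponent k (P * Q) = ∑ p ∈ antidiagonal k,
      homogeneousComponent p.1 P * homogeneousComponent p.2 Q := by
  ext w
  have hsplit : ∀ j, ∑ p ∈ antidiagonal k,
      ((if weight (w.take j) = p.1 then coeff (w.take j) P else 0)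
        * if weight (w.drop j) = p.2 then coeff (w.drop j) Q else 0)
      = if weight w = k then coeff (w.take j) P * coeff (w.drop j) Q else 0 := by
    intro j
    rw [← weight_take_add_weight_drop w j]
    simp only [ite_zero_mul_ite_zero, ← Prod.mk_inj, Prod.mk.eta, Finset.sum_ite_eq,
      mem_antidiagonal]
  simp only [map_sum, coeff_mul, coeff_homogeneousComponent]
  rw [Finset.sum_comm, Finset.sum_congr rfl fun j _ => hsplit j, Finset.sum_ite_irrel,
    Finset.sum_const_zero]

theorem homogeneousComponent_eulerDeriv (k : ℕ) (P : NCSeries d) :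
    homogeneousComponent k (eulerDeriv P) = (k : ℝ) • homogeneousComponent k P := by
  ext w
  simp only [coeff_homogeneousComponent, coeff_eulerDeriv, map_smul, smul_eq_mul]
  split_ifs with h
  · rw [h]
  · rw [mul_zero]

theorem homogeneousComponent_dilation (k : ℕ) (t : ℝ) (P : NCSeries d) :
    homogeneousComponent k (dilation t P) = t ^ k • homogeneousComponent k P := by
  ext w
  simp only [coeff_homogeneousComponent, coeff_dilation, map_smul, smul_eq_mul]
  split_ifs with h
  · rw [h]
  · rw [mul_zero]

theorem homogeneousComponent_truncation (k n : ℕ) (P : NCSeries d) :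
    homogeneousComponent k (truncation n P) = if k ≤ n then homogeneousComponent k P else 0 := by
  ext w
  by_cases h : k ≤ n
  · rw [if_pos h]
    simp only [coeff_homogeneousComponent, coeff_truncation]
    split_ifs <;> first | omega | rfl
  · rw [if_neg h, map_zero, coeff_homogeneousComponent, coeff_truncation]
    split_ifs <;> first | omega | rfl

theorem sum_homogeneousComponent {n : ℕ} {P : NCSeries d} (hP : P ∈ weightLE d n) :
    ∑ k ∈ Finset.range (n + 1), homogeneousComponent k P = P := by
  ext w
  simp only [map_sum, coeff_homogeneousComponent, Finset.sum_ite_eq, Finset.mem_range]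
  split_ifs with h
  · rfl
  · rw [hP w (by omega)]

theorem homogeneousComponent_mem_weightLE (k : ℕ) (P : NCSeries d) :
    homogeneousComponent k P ∈ weightLE d k :=
  fun w hw => by rw [coeff_homogeneousComponent, if_neg hw.ne']

theorem homogeneousComponent_eq_zero_of_mem_weightGE {n k : ℕ} (hk : k < n) {P : NCSeries d}
    (h : P ∈ weightGE d n) : homogeneousComponent k P = 0 := by
  rw [homogeneousComponent_eq_of_smodEq hk (SModEq.zero.mpr h), map_zero]

theorem eq_of_forall_smodEq_weightGE {P Q : NCSeries d}
    (h : ∀ n, P ≡ Q [SMOD weightGE d n]) : P = Q := by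
  ext w
  exact smodEq_weightGE_iff.mp (h (weight w + 1)) w (Nat.lt_succ_self _)

theorem sum_mul_sum_smodEq {a b : ℕ → NCSeries d} (ha : ∀ i, a i ∈ weightGE d i)
    (hb : ∀ i, b i ∈ weightGE d i) (n : ℕ) :
    (∑ i ∈ Finset.range n, a i) * (∑ j ∈ Finset.range n, b j)
      ≡ ∑ k ∈ Finset.range n, ∑ p ∈ antidiagonal k, a p.1 * b p.2
      [SMOD weightGE d n] := by
  have h : ∑ k ∈ Finset.range n, ∑ p ∈ antidiagonal k, a p.1 * b p.2
      = ∑ p ∈ Finset.range n ×ˢ Finset.range n with p.1 + p.2 < n, a p.1 * b p.2 := by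
    rw [Finset.sum_sigma']
    refine Finset.sum_bij' (fun x _ => x.2) (fun p _ => ⟨p.1 + p.2, p⟩) ?_ ?_ ?_ ?_ ?_
    all_goals
      simp only [Finset.mem_sigma, Finset.mem_range, mem_antidiagonal, Finset.mem_filter,
        Finset.mem_product]
    · rintro ⟨k, p⟩ hx; dsimp only at hx ⊢; omega
    · rintro p hp; exact ⟨hp.2, trivial⟩
    · rintro ⟨k, p⟩ ⟨_, hk⟩; dsimp only at hk; rw [hk]
    · exact fun _ _ => trivial
    · exact fun _ _ => trivial
  rw [SModEq.sub_mem, h, Finset.sum_mul_sum, ← Finset.sum_product',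
    ← Finset.sum_filter_add_sum_filter_not _ (fun p : ℕ × ℕ => p.1 + p.2 < n),
    add_sub_cancel_left]
  refine sum_mem fun p hp => weightGE_antitone ?_ (mul_mem_weightGE_add (ha _) (hb _))
  exact not_lt.mp (Finset.mem_filter.mp hp).2

end NCSeries

/-! ### Exponential and logarithm -/

section TwoSidedIdeal

variable {A : Type*} [Ring A] {I : Ideal A} [I.IsTwoSided] {a a' b b' : A}

theorem smodEq_mul (ha : a ≡ a' [SMOD I]) (hb : b ≡ b' [SMOD I]) : a * b ≡ a' * b' [SMOD I] := by
  rw [SModEq.sub_mem] at ha hb ⊢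
  have hsplit : a * b - a' * b' = (a - a') * b + a' * (b - b') := by noncomm_ring
  exact hsplit ▸ I.add_mem (I.mul_mem_right b ha) (I.mul_mem_left a' hb)

theorem smodEq_aeval {R : Type*} [CommRing R] [Algebra R A] (p : Polynomial R)
    (h : a ≡ b [SMOD I]) : Polynomial.aeval a p ≡ Polynomial.aeval b p [SMOD I] := by
  have hmk : Ideal.Quotient.mkₐ R I a = Ideal.Quotient.mkₐ R I b := h
  change Ideal.Quotient.mkₐ R I _ = Ideal.Quotient.mkₐ R I _
  rw [← Polynomial.aeval_algHom_apply, hmk, Polynomial.aeval_algHom_apply]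

end TwoSidedIdeal

section Polynomial

open Polynomial

/-- The partial sum of order `n` of the exponential series. -/
def expPoly (n : ℕ) : ℝ[X] := ∑ k ∈ Finset.range n, C ((k.factorial : ℝ)⁻¹) * X ^ k

/-- The partial sum of order `n` of the series of `log (1 + X)`. -/
def logPoly (n : ℕ) : ℝ[X] := ∑ k ∈ Finset.range n, C ((-1 : ℝ) ^ k / (k + 1)) * X ^ (k + 1)

theorem expPoly_succ (n : ℕ) :
    expPoly (n + 1) = expPoly n + C ((n.factorial : ℝ)⁻¹) * X ^ n :=
  Finset.sum_range_succ _ n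

theorem coeff_zero_expPoly_succ (n : ℕ) : (expPoly (n + 1)).coeff 0 = 1 := by
  simp [expPoly, Finset.sum_range_succ']

theorem derivative_expPoly_succ (n : ℕ) : derivative (expPoly (n + 1)) = expPoly n := by
  rw [expPoly, expPoly, derivative_sum, Finset.sum_range_succ']
  simp only [pow_zero, mul_one, derivative_C, add_zero, derivative_C_mul_X_pow]
  refine Finset.sum_congr rfl fun k _ => ?_
  rw [Nat.factorial_succ]
  push_cast
  congr 2
  field_simp

theorem X_dvd_logPoly (n : ℕ) : X ∣ logPoly n :=
  Finset.dvd_sum fun k _ => Dvd.dvd.mul_left (dvd_pow_self X k.succ_ne_zero) _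

theorem one_add_X_mul_derivative_logPoly (n : ℕ) :
    (1 + X) * derivative (logPoly n) = 1 - (-X) ^ n := by
  have h : derivative (logPoly n) = ∑ k ∈ Finset.range n, (-X : ℝ[X]) ^ k := by
    rw [logPoly, derivative_sum]
    refine Finset.sum_congr rfl fun k _ => ?_
    have hk : (k : ℝ) + 1 ≠ 0 := by positivity
    rw [derivative_C_mul_X_pow, neg_pow (X : ℝ[X]) k, Nat.cast_add, Nat.cast_one,
      div_mul_cancel₀ _ hk]
    simp
  rw [h, mul_comm, ← geom_sum_mul_neg, sub_neg_eq_add]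

/-- The multiples of `1 + X` are the solutions of `(1 + X) T' = T`. -/
theorem X_pow_succ_dvd_of_X_pow_dvd_one_add_X_mul_derivative_sub {T : ℝ[X]} {n : ℕ}
    (h0 : T.coeff 0 = 0) (h : X ^ n ∣ (1 + X) * derivative T - T) : X ^ (n + 1) ∣ T := by
  rw [X_pow_dvd_iff] at h ⊢
  intro j
  induction j with
  | zero => exact fun _ => h0
  | succ j ih =>
    intro hj
    have hrec := h j (by omega)
    rw [add_mul, one_mul, coeff_sub, coeff_add, coeff_derivative, ih (by omega), sub_zero] at hrec
    have hX : (X * derivative T).coeff j = 0 := by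
      cases j with
      | zero => simp
      | succ j => rw [coeff_X_mul, coeff_derivative, ih (by omega), zero_mul]
    rw [hX, add_zero] at hrec
    exact (mul_eq_zero.mp hrec).resolve_right (by positivity)

theorem X_pow_dvd_expPoly_comp_logPoly_sub (n : ℕ) :
    X ^ (n + 1) ∣ (expPoly (n + 1)).comp (logPoly n) - (1 + X) := by
  have hlog0 : (logPoly n).coeff 0 = 0 := X_dvd_iff.mp (X_dvd_logPoly n)
  apply X_pow_succ_dvd_of_X_pow_dvd_one_add_X_mul_derivative_sub
  · rw [coeff_sub, coeff_zero_eq_eval_zero, eval_comp, ← coeff_zero_eq_eval_zero, hlog0,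
      ← coeff_zero_eq_eval_zero, coeff_zero_expPoly_succ]
    simp
  · have hode : (1 + X) * derivative ((expPoly (n + 1)).comp (logPoly n) - (1 + X))
          - ((expPoly (n + 1)).comp (logPoly n) - (1 + X))
        = -((-X) ^ n * (expPoly n).comp (logPoly n) + C ((n.factorial : ℝ)⁻¹) * logPoly n ^ n) := by
      rw [derivative_sub, derivative_comp, derivative_expPoly_succ, mul_sub, ← mul_assoc,
        one_add_X_mul_derivative_logPoly, expPoly_succ]
      simp only [derivative_add, derivative_one, derivative_X, add_comp, mul_comp, C_comp,
        X_pow_comp]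
      ring
    rw [hode, dvd_neg]
    refine dvd_add (Dvd.dvd.mul_right ?_ _) (Dvd.dvd.mul_left ?_ _)
    · exact pow_dvd_pow_of_dvd (dvd_neg.mpr dvd_rfl) n
    · exact pow_dvd_pow_of_dvd (X_dvd_logPoly n) n

end Polynomial

namespace NCSeries

variable {d : ℕ}

/-- The exponential of a series without constant term. -/
def exp (P : NCSeries d) : NCSeries d := ofSeries (sExp P)

/-- The logarithm of a series with constant term `1`. -/
def log (Q : NCSeries d) : NCSeries d := ofSeries (sLog Q)

theorem coeff_exp (w : Word d) (P : NCSeries d) : coeff w (exp P)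
    = ∑ k ∈ Finset.range (w.length + 1), (k.factorial : ℝ)⁻¹ * coeff w (P ^ k) := by
  change ∑ k ∈ Finset.range (w.length + 1), sPow P k w / (k.factorial : ℝ) = _
  refine Finset.sum_congr rfl fun k _ => ?_
  rw [sPow_eq_pow, div_eq_inv_mul]
  rfl

theorem coeff_log (w : Word d) (Q : NCSeries d) : coeff w (log Q)
    = ∑ k ∈ Finset.range w.length, (-1 : ℝ) ^ k / (k + 1) * coeff w ((Q - 1) ^ (k + 1)) := by
  have hsum : coeff w (log Q)
      = ∑ k ∈ Finset.Icc 1 w.length, (-1 : ℝ) ^ (k - 1) * coeff w ((Q - 1) ^ k) / (k : ℝ) := by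
    simp only [← sPow_eq_pow]
    rfl
  rw [hsum, ← Finset.Ico_add_one_right_eq_Icc, Finset.sum_Ico_eq_sum_range, Nat.add_sub_cancel]
  refine Finset.sum_congr rfl fun k _ => ?_
  rw [add_comm 1 k, Nat.add_sub_cancel, div_mul_eq_mul_div, Nat.cast_add, Nat.cast_one]

theorem dilation_exp (t : ℝ) (P : NCSeries d) : dilation t (exp P) = exp (dilation t P) := by
  ext w
  simp only [coeff_dilation, coeff_exp, ← map_pow, Finset.mul_sum]
  exact Finset.sum_congr rfl fun k _ => by ring

theorem dilation_log (t : ℝ) (Q : NCSeries d) : dilation t (log Q) = log (dilation t Q) := by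
  have hsub : dilation t Q - 1 = dilation t (Q - 1) := by rw [map_sub, map_one]
  ext w
  rw [coeff_dilation, coeff_log, coeff_log, hsub]
  simp only [← map_pow, coeff_dilation, Finset.mul_sum]
  exact Finset.sum_congr rfl fun k _ => by ring

theorem coeff_pow_eq_zero_of_length_lt {P : NCSeries d} (hP : P ∈ weightGE d 1) (k : ℕ) {w : Word d}
    (hw : w.length < k) : coeff w (P ^ k) = 0 := by
  induction k generalizing w with
  | zero => exact absurd hw (Nat.not_lt_zero _)
  | succ k ih =>
    rw [pow_succ', coeff_mul]
    refine Finset.sum_eq_zero fun j _ => ?_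
    by_cases hj : w.take j = []
    · rw [hj, mem_weightGE_one_iff.mp hP, zero_mul]
    · rw [List.take_eq_nil_iff, not_or] at hj
      have := List.length_pos_iff.mpr hj.2
      rw [ih (by rw [List.length_drop]; omega), mul_zero]

theorem exp_smodEq {P : NCSeries d} (hP : P ∈ weightGE d 1) (n : ℕ) :
    exp P ≡ Polynomial.aeval P (expPoly n) [SMOD weightGE d n] := by
  refine smodEq_weightGE_iff.mpr fun w hw => ?_
  simp only [coeff_exp, expPoly, map_sum, map_mul, Polynomial.aeval_C, map_pow, Polynomial.aeval_X,
    ← Algebra.smul_def, map_smul, smul_eq_mul]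
  refine Finset.sum_subset (Finset.range_mono ((length_le_weight w).trans_lt hw)) fun k _ hk => ?_
  rw [Finset.mem_range, not_lt] at hk
  rw [coeff_pow_eq_zero_of_length_lt hP k hk, mul_zero]

theorem log_smodEq {Q : NCSeries d} (hQ : Q ≡ 1 [SMOD weightGE d 1]) (n : ℕ) :
    log Q ≡ Polynomial.aeval (Q - 1) (logPoly n) [SMOD weightGE d (n + 1)] := by
  rw [SModEq.sub_mem] at hQ
  refine smodEq_weightGE_iff.mpr fun w hw => ?_
  simp only [coeff_log, logPoly, map_sum, map_mul, Polynomial.aeval_C, map_pow, Polynomial.aeval_X,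
    ← Algebra.smul_def, map_smul, smul_eq_mul]
  refine Finset.sum_subset (Finset.range_mono ?_) fun k _ hk => ?_
  · exact (length_le_weight w).trans (Nat.lt_succ_iff.mp hw)
  · rw [Finset.mem_range, not_lt] at hk
    rw [coeff_pow_eq_zero_of_length_lt hQ _ (Nat.lt_succ_of_le hk), mul_zero]

theorem exp_smodEq_one {P : NCSeries d} (hP : P ∈ weightGE d 1) :
    exp P ≡ 1 [SMOD weightGE d 1] := by
  simpa [expPoly] using exp_smodEq hP 1

theorem log_mem_weightGE_one {Q : NCSeries d} (hQ : Q ≡ 1 [SMOD weightGE d 1]) :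
    log Q ∈ weightGE d 1 := by
  simpa [logPoly, SModEq.zero] using log_smodEq hQ 0

theorem exp_log {Q : NCSeries d} (hQ : Q ≡ 1 [SMOD weightGE d 1]) : exp (log Q) = Q := by
  refine eq_of_forall_smodEq_weightGE fun n => SModEq.mono (weightGE_antitone n.le_succ) ?_
  have hQ' : Q - 1 ∈ weightGE d 1 := SModEq.sub_mem.mp hQ
  calc exp (log Q)
      ≡ Polynomial.aeval (log Q) (expPoly (n + 1)) [SMOD weightGE d (n + 1)] :=
        exp_smodEq (log_mem_weightGE_one hQ) (n + 1)
    _ ≡ Polynomial.aeval (Q - 1) ((expPoly (n + 1)).comp (logPoly n))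
          [SMOD weightGE d (n + 1)] := by
        rw [Polynomial.aeval_comp]
        exact smodEq_aeval _ (log_smodEq hQ n)
    _ ≡ Polynomial.aeval (Q - 1) (1 + Polynomial.X : Polynomial ℝ) [SMOD weightGE d (n + 1)] := by
        obtain ⟨q, hq⟩ := X_pow_dvd_expPoly_comp_logPoly_sub n
        rw [SModEq.sub_mem, ← map_sub, hq, map_mul, map_pow, Polynomial.aeval_X]
        exact Ideal.mul_mem_right _ _ (pow_mem_weightGE hQ' _)
    _ = Q := by simp

/-- An ideal is weight-adically closed if it contains every series that agrees up to any given
weight with one of its elements. -/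
def IsWeightClosed (I : Ideal (NCSeries d)) : Prop :=
  ∀ P, (∀ n, ∃ Q ∈ I, P ≡ Q [SMOD weightGE d n]) → P ∈ I

theorem isWeightClosed_weightGE (n : ℕ) : IsWeightClosed (weightGE d n) := fun P h => by
  obtain ⟨Q, hQ, hPQ⟩ := h n
  exact SModEq.zero.mp (hPQ.trans (SModEq.zero.mpr hQ))

namespace IsWeightClosed

variable {I : Ideal (NCSeries d)}

theorem smodEq (hI : IsWeightClosed I) {P P' : NCSeries d}
    (h : ∀ n, ∃ Q Q', P ≡ Q [SMOD weightGE d n] ∧ P' ≡ Q' [SMOD weightGE d n] ∧ Q ≡ Q' [SMOD I]) :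
    P ≡ P' [SMOD I] := by
  refine SModEq.sub_mem.mpr (hI _ fun n => ?_)
  obtain ⟨Q, Q', hPQ, hPQ', hQQ'⟩ := h n
  exact ⟨Q - Q', SModEq.sub_mem.mp hQQ', hPQ.sub hPQ'⟩

variable [I.IsTwoSided]

theorem exp_smodEq_exp (hI : IsWeightClosed I) {P P' : NCSeries d} (hP : P ∈ weightGE d 1)
    (hP' : P' ∈ weightGE d 1) (h : P ≡ P' [SMOD I]) : exp P ≡ exp P' [SMOD I] :=
  hI.smodEq fun n => ⟨_, _, exp_smodEq hP n, exp_smodEq hP' n, smodEq_aeval _ h⟩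

theorem log_smodEq_log (hI : IsWeightClosed I) {Q Q' : NCSeries d}
    (hQ : Q ≡ 1 [SMOD weightGE d 1]) (hQ' : Q' ≡ 1 [SMOD weightGE d 1]) (h : Q ≡ Q' [SMOD I]) :
    log Q ≡ log Q' [SMOD I] :=
  hI.smodEq fun n => ⟨_, _, (log_smodEq hQ n).mono (weightGE_antitone n.le_succ),
    (log_smodEq hQ' n).mono (weightGE_antitone n.le_succ), smodEq_aeval _ (h.sub SModEq.rfl)⟩

end IsWeightClosed

/-- The product `exp(z_1) ⋯ exp(z_n)`. -/
def expProd (l : List (NCSeries d)) : NCSeries d := (l.map exp).prod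

@[simp] theorem expProd_nil : expProd ([] : List (NCSeries d)) = 1 := rfl

@[simp] theorem expProd_cons (z : NCSeries d) (l : List (NCSeries d)) :
    expProd (z :: l) = exp z * expProd l := rfl

theorem expProd_append (l l' : List (NCSeries d)) :
    expProd (l ++ l') = expProd l * expProd l' := by
  simp [expProd]

theorem dilation_expProd (t : ℝ) (l : List (NCSeries d)) :
    dilation t (expProd l) = expProd (l.map (dilation t)) := by
  induction l with
  | nil => exact map_one _
  | cons z l ih => rw [List.map_cons, expProd_cons, expProd_cons, map_mul, dilation_exp, ih]

theorem ofSeries_bch (l : List (Series d)) :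
    ofSeries (bch l) = log (expProd (l.map ofSeries)) := by
  have hprod : ofSeries ((l.map sExp).foldr sMul (sOne d)) = expProd (l.map ofSeries) := by
    induction l with
    | nil => rfl
    | cons a l ih => change _ = exp (ofSeries a) * expProd (l.map ofSeries); rw [← ih]; rfl
  rw [← hprod]
  rfl

theorem expProd_smodEq_one {l : List (NCSeries d)} (hl : ∀ z ∈ l, z ∈ weightGE d 1) :
    expProd l ≡ 1 [SMOD weightGE d 1] := by
  induction l with
  | nil => rfl
  | cons z l ih =>
    rw [List.forall_mem_cons] at hl
    simpa using smodEq_mul (exp_smodEq_one hl.1) (ih hl.2)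

theorem IsWeightClosed.expProd_smodEq_expProd {I : Ideal (NCSeries d)} [I.IsTwoSided]
    (hI : IsWeightClosed I) {ι : Type*} {z z' : ι → NCSeries d} (hz : ∀ i, z i ∈ weightGE d 1)
    (hz' : ∀ i, z' i ∈ weightGE d 1) (h : ∀ i, z i ≡ z' i [SMOD I]) (l : List ι) :
    expProd (l.map z) ≡ expProd (l.map z') [SMOD I] := by
  induction l with
  | nil => rfl
  | cons i l ih => exact smodEq_mul (hI.exp_smodEq_exp (hz i) (hz' i) (h i)) ih

end NCSeries

/-! ### Divided powers and the adjoint action -/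

attribute [local instance] LieRing.ofAssociativeRing

section DivPow

variable {A : Type*} [Ring A] [Algebra ℝ A]

/-- The divided power `z ^ k / k!`. -/
def divPow (k : ℕ) (z : A) : A := (k.factorial : ℝ)⁻¹ • z ^ k

theorem divPow_add_of_commute {x y : A} (h : Commute x y) (k : ℕ) :
    divPow k (x + y) = ∑ p ∈ antidiagonal k, divPow p.1 x * divPow p.2 y := by
  rw [divPow, h.add_pow', Finset.smul_sum]
  refine Finset.sum_congr rfl fun p hp => ?_
  have hfact : ((k.choose p.2 * p.1.factorial * p.2.factorial : ℕ) : ℝ) = k.factorial := by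
    rw [← mem_antidiagonal.mp hp, Nat.add_choose_mul_factorial_mul_factorial]
  have hk : (k.factorial : ℝ) ≠ 0 := by positivity
  rw [divPow, divPow, smul_mul_smul_comm, ← Nat.cast_smul_eq_nsmul ℝ, smul_smul,
    Nat.choose_symm_of_eq_add (mem_antidiagonal.mp hp).symm]
  congr 1
  push_cast at hfact
  field_simp
  linarith

theorem divPow_mul (z X : A) (k : ℕ) :
    divPow k z * X = ∑ p ∈ antidiagonal k, divPow p.1 (LieAlgebra.ad ℝ A z) X * divPow p.2 z := by
  have hmulLeft : LinearMap.mulLeft ℝ z = LinearMap.mulRight ℝ z + LieAlgebra.ad ℝ A z := by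
    rw [LieAlgebra.ad_eq_lmul_left_sub_lmul_right]
    exact (add_sub_cancel _ _).symm
  have hcomm : Commute (LinearMap.mulRight ℝ z) (LieAlgebra.ad ℝ A z) := by
    rw [LieAlgebra.ad_eq_lmul_left_sub_lmul_right]
    exact (LinearMap.commute_mulLeft_right z z).symm.sub_right (Commute.refl _)
  calc divPow k z * X = divPow k (LinearMap.mulLeft ℝ z) X := by
        simp [divPow, LinearMap.pow_mulLeft]
    _ = ∑ p ∈ antidiagonal k,
          (divPow p.1 (LinearMap.mulRight ℝ z) * divPow p.2 (LieAlgebra.ad ℝ A z)) X := by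
        rw [hmulLeft, divPow_add_of_commute hcomm, LinearMap.sum_apply]
    _ = ∑ p ∈ antidiagonal k, divPow p.1 (LieAlgebra.ad ℝ A z) X * divPow p.2 z := by
        rw [← Finset.Nat.sum_antidiagonal_swap]
        simp only [divPow, LinearMap.pow_mulRight, Module.End.mul_apply, LinearMap.smul_apply,
          LinearMap.mulRight_apply, smul_mul_assoc, mul_smul_comm, Prod.fst_swap, Prod.snd_swap]
        exact Finset.sum_congr rfl fun p _ => smul_comm _ _ _

/-- In the algebra of endomorphisms `[z, D] = -D z`, where `z` stands for the multiplication by `z`;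
so the formula is `divPow_mul` for `z` and `D` in that algebra, evaluated at `1`. -/
theorem derivation_divPow_succ {D : A →ₗ[ℝ] A} (hD : ∀ x y, D (x * y) = D x * y + x * D y) (z : A)
    (k : ℕ) :
    D (divPow (k + 1) z) = ∑ p ∈ antidiagonal k,
      (((p.1 + 1).factorial : ℝ)⁻¹ • (LieAlgebra.ad ℝ A z ^ p.1) (D z)) * divPow p.2 z := by
  have hone : D 1 = 0 := by simpa using hD 1 1
  let adMul := LieAlgebra.ad ℝ (Module.End ℝ A) (LinearMap.mulLeft ℝ z)
  have had : ∀ i, (adMul ^ (i + 1)) D = -LinearMap.mulLeft ℝ ((LieAlgebra.ad ℝ A z ^ i) (D z)) := by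
    intro i
    induction i with
    | zero =>
      ext X
      simp [adMul, LieRing.of_associative_ring_bracket, hD]
    | succ i ih =>
      rw [pow_succ', Module.End.mul_apply, ih, pow_succ', Module.End.mul_apply]
      ext X
      simp [adMul, LieRing.of_associative_ring_bracket, sub_mul, mul_assoc, neg_add_eq_sub]
  have h := congrArg (fun f : Module.End ℝ A => f 1)
    (divPow_mul (LinearMap.mulLeft ℝ z : Module.End ℝ A) D (k + 1))
  rw [Finset.Nat.sum_antidiagonal_succ] at h
  simp only [divPow, LinearMap.pow_mulLeft, Module.End.mul_apply, LinearMap.smul_apply,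
    LinearMap.add_apply, LinearMap.sum_apply, LinearMap.mulLeft_apply, LinearMap.neg_apply, had,
    adMul, hone, mul_one, mul_zero, smul_zero, pow_zero, Module.End.one_apply, Nat.factorial_zero,
    Nat.cast_one, inv_one, one_smul, smul_neg, Finset.sum_neg_distrib] at h
  rw [divPow, eq_neg_of_add_eq_zero_left h.symm, neg_neg]
  simp only [divPow, smul_mul_assoc]

end DivPow

namespace NCSeries

variable {d : ℕ}

/-! ### Lie series -/

/-- The Lie algebra of Lie polynomials. -/
def liePoly (d : ℕ) : LieSubalgebra ℝ (NCSeries d) where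
  carrier := {P | IsLiePolynomial P}
  add_mem' := IsLiePolynomial.add
  zero_mem' := IsLiePolynomial.zero
  smul_mem' := IsLiePolynomial.smul
  lie_mem' := IsLiePolynomial.bracket

theorem coeff_nil_of_mem_liePoly {P : NCSeries d} (hP : P ∈ liePoly d) : coeff [] P = 0 := by
  induction (hP : IsLiePolynomial P) with
  | letter i =>
    change (if [] = [i] then (1 : ℝ) else 0) = 0
    simp
  | zero => rfl
  | @add P Q _ _ hP hQ =>
    change coeff [] (ofSeries P + ofSeries Q) = 0
    rw [map_add, show coeff [] (ofSeries P) = 0 from hP, show coeff [] (ofSeries Q) = 0 from hQ,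
      add_zero]
  | @smul c P _ hP =>
    change coeff [] (c • ofSeries P) = 0
    rw [map_smul, show coeff [] (ofSeries P) = 0 from hP, smul_zero]
  | @bracket P Q =>
    change coeff [] (ofSeries P * ofSeries Q - ofSeries Q * ofSeries P) = 0
    rw [map_sub, coeff_nil_mul, coeff_nil_mul, mul_comm, sub_self]

theorem homogeneousComponent_lie (k : ℕ) (P Q : NCSeries d) :
    homogeneousComponent k ⁅P, Q⁆ = ∑ p ∈ antidiagonal k,
      ⁅homogeneousComponent p.1 P, homogeneousComponent p.2 Q⁆ := by
  simp only [LieRing.of_associative_ring_bracket, map_sub, homogeneousComponent_mul,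
    Finset.sum_sub_distrib]
  rw [← Finset.Nat.sum_antidiagonal_swap (n := k)
    (f := fun p => homogeneousComponent p.1 Q * homogeneousComponent p.2 P)]
  rfl

/-- The Lie algebra of Lie series. -/
def lieSeries (d : ℕ) : LieSubalgebra ℝ (NCSeries d) where
  carrier := {P | ∀ k, homogeneousComponent k P ∈ liePoly d}
  add_mem' hP hQ k := by rw [map_add]; exact add_mem (hP k) (hQ k)
  zero_mem' k := by rw [map_zero]; exact zero_mem _
  smul_mem' c P hP k := by rw [map_smul]; exact (liePoly d).smul_mem c (hP k)
  lie_mem' hP hQ k := by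
    rw [homogeneousComponent_lie]
    exact sum_mem fun p _ => (liePoly d).lie_mem (hP p.1) (hQ p.2)

theorem isLieSeries_iff {P : Series d} : IsLieSeries P ↔ ofSeries P ∈ lieSeries d :=
  forall_congr' fun k => iff_of_eq (congrArg (· ∈ liePoly d) (ofSeries_component k P))

theorem mem_weightGE_one_of_mem_lieSeries {P : NCSeries d} (hP : P ∈ lieSeries d) :
    P ∈ weightGE d 1 := by
  rw [mem_weightGE_one_iff, ← coeff_nil_of_mem_liePoly (hP 0), coeff_homogeneousComponent,
    if_pos weight_nil]

theorem eulerDeriv_mem_lieSeries {P : NCSeries d} (hP : P ∈ lieSeries d) :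
    eulerDeriv P ∈ lieSeries d := fun k => by
  rw [homogeneousComponent_eulerDeriv]
  exact (liePoly d).smul_mem _ (hP k)

theorem truncation_mem_lieSeries {P : NCSeries d} (hP : P ∈ lieSeries d) (n : ℕ) :
    truncation n P ∈ lieSeries d := fun k => by
  rw [homogeneousComponent_truncation]
  split_ifs
  exacts [hP k, zero_mem _]

theorem dilation_mem_lieSeries {P : NCSeries d} (hP : P ∈ lieSeries d) (t : ℝ) :
    dilation t P ∈ lieSeries d := fun k => by
  rw [homogeneousComponent_dilation]
  exact (liePoly d).smul_mem _ (hP k)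

theorem mem_liePoly_of_mem_weightLE {P : NCSeries d} (hP : P ∈ lieSeries d) {n : ℕ}
    (hn : P ∈ weightLE d n) : P ∈ liePoly d := by
  rw [← sum_homogeneousComponent hn]
  exact sum_mem fun k _ => hP k

theorem ad_pow_mem_lieSeries {P Q : NCSeries d} (hP : P ∈ lieSeries d) (hQ : Q ∈ lieSeries d)
    (i : ℕ) : (LieAlgebra.ad ℝ _ P ^ i) Q ∈ lieSeries d := by
  rw [← LieSubalgebra.coe_ad_pow ℝ _ (lieSeries d) ⟨P, hP⟩ ⟨Q, hQ⟩ i]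
  exact SetLike.coe_mem _

/-! ### The Baker–Campbell–Hausdorff theorem -/

theorem lie_mem_weightGE_add {i j : ℕ} {P Q : NCSeries d} (hP : P ∈ weightGE d i)
    (hQ : Q ∈ weightGE d j) : ⁅P, Q⁆ ∈ weightGE d (i + j) :=
  sub_mem (mul_mem_weightGE_add hP hQ) (add_comm i j ▸ mul_mem_weightGE_add hQ hP)

theorem ad_pow_mem_weightGE_add {j : ℕ} {P Q : NCSeries d} (hP : P ∈ weightGE d 1)
    (hQ : Q ∈ weightGE d j) (i : ℕ) : (LieAlgebra.ad ℝ _ P ^ i) Q ∈ weightGE d (i + j) := by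
  induction i with
  | zero => simpa using hQ
  | succ i ih =>
    rw [pow_succ', Module.End.mul_apply, add_comm i 1, add_assoc]
    exact lie_mem_weightGE_add hP ih

theorem smul_mem_weightGE {n : ℕ} {P : NCSeries d} (c : ℝ) (hP : P ∈ weightGE d n) :
    c • P ∈ weightGE d n :=
  Submodule.smul_of_tower_mem _ c hP

theorem divPow_mem_weightGE {P : NCSeries d} (hP : P ∈ weightGE d 1) (k : ℕ) :
    divPow k P ∈ weightGE d k :=
  smul_mem_weightGE _ (pow_mem_weightGE hP k)

theorem exp_smodEq_sum_divPow {P : NCSeries d} (hP : P ∈ weightGE d 1) (n : ℕ) :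
    exp P ≡ ∑ k ∈ Finset.range n, divPow k P [SMOD weightGE d n] := by
  simpa [expPoly, divPow, Algebra.smul_def] using exp_smodEq hP n

/-- `exp(z) H exp(-z) = exp(ad z) H`, truncated. -/
theorem exp_mul_smodEq {z : NCSeries d} (hz : z ∈ weightGE d 1) (H : NCSeries d) (n : ℕ) :
    exp z * H ≡ (∑ i ∈ Finset.range n, divPow i (LieAlgebra.ad ℝ _ z) H) * exp z
      [SMOD weightGE d n] := by
  have had : ∀ i, divPow i (LieAlgebra.ad ℝ _ z) H ∈ weightGE d i := fun i =>
    smul_mem_weightGE _ (ad_pow_mem_weightGE_add hz (mem_weightGE_zero H) i)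
  calc exp z * H
      ≡ (∑ k ∈ Finset.range n, divPow k z) * H [SMOD weightGE d n] :=
        smodEq_mul (exp_smodEq_sum_divPow hz n) SModEq.rfl
    _ = ∑ k ∈ Finset.range n, ∑ p ∈ antidiagonal k,
          divPow p.1 (LieAlgebra.ad ℝ _ z) H * divPow p.2 z := by
        simp only [Finset.sum_mul, divPow_mul]
    _ ≡ (∑ i ∈ Finset.range n, divPow i (LieAlgebra.ad ℝ _ z) H)
          * ∑ k ∈ Finset.range n, divPow k z [SMOD weightGE d n] :=
        (sum_mul_sum_smodEq had (divPow_mem_weightGE hz) n).symm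
    _ ≡ (∑ i ∈ Finset.range n, divPow i (LieAlgebra.ad ℝ _ z) H) * exp z [SMOD weightGE d n] :=
        smodEq_mul SModEq.rfl (exp_smodEq_sum_divPow hz n).symm

/-- The partial sum of order `n` of the series `((e^{ad z} - 1) / ad z) Y`, which is the logarithmic
derivative of `exp z` when `Y` is the derivative of `z`. -/
def dexpSum (n : ℕ) (z Y : NCSeries d) : NCSeries d :=
  ∑ i ∈ Finset.range n, ((i + 1).factorial : ℝ)⁻¹ • (LieAlgebra.ad ℝ _ z ^ i) Y

theorem dexpSum_mem_lieSeries {z Y : NCSeries d} (hz : z ∈ lieSeries d) (hY : Y ∈ lieSeries d)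
    (n : ℕ) : dexpSum n z Y ∈ lieSeries d :=
  sum_mem fun i _ => (lieSeries d).smul_mem _ (ad_pow_mem_lieSeries hz hY i)

theorem eulerDeriv_exp_smodEq {z : NCSeries d} (hz : z ∈ weightGE d 1) (n : ℕ) :
    eulerDeriv (exp z) ≡ dexpSum n z (eulerDeriv z) * exp z [SMOD weightGE d n] := by
  have had : ∀ i, ((i + 1).factorial : ℝ)⁻¹ • (LieAlgebra.ad ℝ _ z ^ i) (eulerDeriv z)
      ∈ weightGE d i := fun i =>
    smul_mem_weightGE _ (ad_pow_mem_weightGE_add hz (mem_weightGE_zero _) i)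
  calc eulerDeriv (exp z)
      ≡ eulerDeriv (∑ k ∈ Finset.range (n + 1), divPow k z) [SMOD weightGE d n] :=
        (smodEq_eulerDeriv (exp_smodEq_sum_divPow hz (n + 1))).mono (weightGE_antitone n.le_succ)
    _ = ∑ k ∈ Finset.range n, eulerDeriv (divPow (k + 1) z) := by
        rw [Finset.sum_range_succ', map_add, map_sum]
        simp [divPow, eulerDeriv_one]
    _ = ∑ k ∈ Finset.range n, ∑ p ∈ antidiagonal k, (((p.1 + 1).factorial : ℝ)⁻¹ •
          (LieAlgebra.ad ℝ _ z ^ p.1) (eulerDeriv z)) * divPow p.2 z := by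
        simp only [derivation_divPow_succ eulerDeriv_mul]
    _ ≡ dexpSum n z (eulerDeriv z) * ∑ k ∈ Finset.range n, divPow k z [SMOD weightGE d n] :=
        (sum_mul_sum_smodEq had (divPow_mem_weightGE hz) n).symm
    _ ≡ dexpSum n z (eulerDeriv z) * exp z [SMOD weightGE d n] :=
        smodEq_mul SModEq.rfl (exp_smodEq_sum_divPow hz n).symm

theorem exists_eulerDeriv_expProd_smodEq {l : List (NCSeries d)} (hl : ∀ z ∈ l, z ∈ lieSeries d)
    (n : ℕ) :
    ∃ H ∈ lieSeries d, eulerDeriv (expProd l) ≡ H * expProd l [SMOD weightGE d n] := by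
  induction l with
  | nil => exact ⟨0, zero_mem _, by simp [eulerDeriv_one]⟩
  | cons z l ih =>
    rw [List.forall_mem_cons] at hl
    obtain ⟨hz, hl⟩ := hl
    obtain ⟨H, hH, hHl⟩ := ih hl
    have hz1 := mem_weightGE_one_of_mem_lieSeries hz
    let G := dexpSum n z (eulerDeriv z)
    let adH := ∑ i ∈ Finset.range n, divPow i (LieAlgebra.ad ℝ _ z) H
    have hG : G ∈ lieSeries d := dexpSum_mem_lieSeries hz (eulerDeriv_mem_lieSeries hz) n
    have hadH : adH ∈ lieSeries d :=
      sum_mem fun i _ => (lieSeries d).smul_mem _ (ad_pow_mem_lieSeries hz hH i)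
    refine ⟨G + adH, add_mem hG hadH, ?_⟩
    calc eulerDeriv (expProd (z :: l))
        = eulerDeriv (exp z) * expProd l + exp z * eulerDeriv (expProd l) := by
          rw [expProd_cons, eulerDeriv_mul]
      _ ≡ G * exp z * expProd l + exp z * (H * expProd l) [SMOD weightGE d n] :=
          (smodEq_mul (eulerDeriv_exp_smodEq hz1 n) SModEq.rfl).add (smodEq_mul SModEq.rfl hHl)
      _ ≡ G * exp z * expProd l + adH * exp z * expProd l [SMOD weightGE d n] := by
          rw [← mul_assoc (exp z)]
          exact SModEq.rfl.add (smodEq_mul (exp_mul_smodEq hz1 H n) SModEq.rfl)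
      _ = (G + adH) * expProd (z :: l) := by rw [expProd_cons]; noncomm_ring

theorem smodEq_of_mul_right {n : ℕ} {X Y Q : NCSeries d} (hQ : Q ≡ 1 [SMOD weightGE d 1])
    (h : X * Q ≡ Y * Q [SMOD weightGE d n]) : X ≡ Y [SMOD weightGE d n] := by
  rw [SModEq.sub_mem] at hQ h ⊢
  suffices hj : ∀ j ≤ n, X - Y ∈ weightGE d j from hj n le_rfl
  intro j
  induction j with
  | zero => exact fun _ => mem_weightGE_zero _
  | succ j ih =>
    intro hj
    have hsplit : X - Y = (X * Q - Y * Q) - (X - Y) * (Q - 1) := by noncomm_ring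
    rw [hsplit]
    exact sub_mem (weightGE_antitone hj h) (mul_mem_weightGE_add (ih (by omega)) hQ)

theorem smodEq_lie_succ {k : ℕ} {P P' Q Q' : NCSeries d} (hP' : P' ∈ weightGE d 1)
    (hQ : Q ∈ weightGE d 1) (hP : P ≡ P' [SMOD weightGE d k]) (hQQ' : Q ≡ Q' [SMOD weightGE d k]) :
    ⁅P, Q⁆ ≡ ⁅P', Q'⁆ [SMOD weightGE d (k + 1)] := by
  rw [SModEq.sub_mem] at hP hQQ' ⊢
  have hsplit : ⁅P, Q⁆ - ⁅P', Q'⁆ = ⁅P - P', Q⁆ + ⁅P', Q - Q'⁆ := by rw [sub_lie, lie_sub]; abel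
  rw [hsplit]
  exact add_mem (lie_mem_weightGE_add hP hQ) (add_comm k 1 ▸ lie_mem_weightGE_add hP' hQQ')

theorem ad_pow_succ_eulerDeriv_smodEq {k : ℕ} {L L' : NCSeries d} (hL : L ∈ weightGE d 1)
    (hL' : L' ∈ weightGE d 1) (h : L ≡ L' [SMOD weightGE d k]) (i : ℕ) :
    (LieAlgebra.ad ℝ _ L ^ (i + 1)) (eulerDeriv L)
      ≡ (LieAlgebra.ad ℝ _ L' ^ (i + 1)) (eulerDeriv L') [SMOD weightGE d (k + 1)] := by
  have hmem : ∀ i, (LieAlgebra.ad ℝ _ L ^ i) (eulerDeriv L) ∈ weightGE d 1 := fun i =>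
    weightGE_antitone (Nat.le_add_left 1 i)
      (ad_pow_mem_weightGE_add hL (eulerDeriv_mem_weightGE hL) i)
  induction i with
  | zero => simpa using smodEq_lie_succ hL' (hmem 0) h (smodEq_eulerDeriv h)
  | succ i ih =>
    rw [pow_succ' _ (i + 1), pow_succ' _ (i + 1), Module.End.mul_apply, Module.End.mul_apply]
    exact smodEq_lie_succ hL' (hmem _) h (ih.mono (weightGE_antitone k.le_succ))

theorem dexpSum_succ_eulerDeriv_sub_smodEq {k : ℕ} {L L' : NCSeries d} (hL : L ∈ weightGE d 1)
    (hL' : L' ∈ weightGE d 1) (h : L ≡ L' [SMOD weightGE d k]) (n : ℕ) :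
    dexpSum (n + 1) L (eulerDeriv L) - eulerDeriv L
      ≡ dexpSum (n + 1) L' (eulerDeriv L') - eulerDeriv L' [SMOD weightGE d (k + 1)] := by
  simp only [dexpSum, Finset.sum_range_succ', zero_add, Nat.factorial_one, Nat.cast_one, inv_one,
    one_smul, pow_zero, Module.End.one_apply, add_sub_cancel_right]
  refine SModEq.sum fun i _ => ?_
  have := ad_pow_succ_eulerDeriv_smodEq hL hL' h i
  rw [SModEq.sub_mem] at this ⊢
  rw [← smul_sub]
  exact smul_mem_weightGE _ this

/-- The logarithmic derivative of `exp L` is `eulerDeriv L` plus terms whose component of weight `k`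
depends only on the components of `L` of lower weight. -/
theorem mem_lieSeries_of_eulerDeriv_exp {L : NCSeries d} (hL : L ∈ weightGE d 1)
    (h : ∀ n, ∃ H ∈ lieSeries d, eulerDeriv (exp L) ≡ H * exp L [SMOD weightGE d n]) :
    L ∈ lieSeries d := by
  intro k
  induction k using Nat.strong_induction_on with
  | _ k ih =>
    rcases k with _ | k
    · rw [homogeneousComponent_eq_zero_of_mem_weightGE Nat.zero_lt_one hL]
      exact zero_mem _
    let L' := truncation k L
    have hL' : L' ∈ lieSeries d := fun j => by
      rw [homogeneousComponent_truncation]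
      split_ifs with hj
      exacts [ih j (by omega), zero_mem _]
    obtain ⟨H, hH, hHL⟩ := h (k + 2)
    have hHdexp : H ≡ dexpSum (k + 2) L (eulerDeriv L) [SMOD weightGE d (k + 2)] :=
      smodEq_of_mul_right (exp_smodEq_one hL) (hHL.symm.trans (eulerDeriv_exp_smodEq hL (k + 2)))
    let K := H - (dexpSum (k + 2) L' (eulerDeriv L') - eulerDeriv L')
    have hK : K ∈ lieSeries d := sub_mem hH
      (sub_mem (dexpSum_mem_lieSeries hL' (eulerDeriv_mem_lieSeries hL') _)
        (eulerDeriv_mem_lieSeries hL'))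
    have hKL : K ≡ eulerDeriv L [SMOD weightGE d (k + 2)] := by
      have := hHdexp.sub (dexpSum_succ_eulerDeriv_sub_smodEq hL
        (mem_weightGE_one_of_mem_lieSeries hL') (truncation_smodEq k L).symm (k + 1)).symm
      rwa [sub_sub_cancel] at this
    have hcomp : ((k + 1 : ℕ) : ℝ) • homogeneousComponent (k + 1) L ∈ liePoly d := by
      rw [← homogeneousComponent_eulerDeriv,
        ← homogeneousComponent_eq_of_smodEq (Nat.lt_succ_self (k + 1)) hKL]
      exact hK (k + 1)
    simpa [smul_smul, Nat.cast_add_one_ne_zero] using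
      (liePoly d).smul_mem ((k + 1 : ℕ) : ℝ)⁻¹ hcomp

theorem log_expProd_mem_lieSeries {l : List (NCSeries d)} (hl : ∀ z ∈ l, z ∈ lieSeries d) :
    log (expProd l) ∈ lieSeries d := by
  have h1 : expProd l ≡ 1 [SMOD weightGE d 1] :=
    expProd_smodEq_one fun z hz => mem_weightGE_one_of_mem_lieSeries (hl z hz)
  refine mem_lieSeries_of_eulerDeriv_exp (log_mem_weightGE_one h1) fun n => ?_
  rw [exp_log h1]
  exact exists_eulerDeriv_expProd_smodEq hl n

end NCSeries

/-! ### Bounded smooth vector fields -/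

/-- The Euclidean space `ℝ^N`. -/
abbrev Euc (N : ℕ) : Type := EuclideanSpace ℝ (Fin N)

open scoped ContDiff

section CbSmooth

variable {N : ℕ}

theorem IsCbSmooth.sum_smul {ι : Type*} (S : Finset ι) (c : ι → ℝ) {F : ι → Euc N → Euc N}
    (hF : ∀ i ∈ S, IsCbSmooth (F i)) : IsCbSmooth (fun x => ∑ i ∈ S, c i • F i x) := by
  refine ⟨ContDiff.sum fun i hi => (hF i hi).1.const_smul (c i), fun n => ?_⟩
  choose! K hK using fun i (hi : i ∈ S) => (hF i hi).2 n
  refine ⟨∑ i ∈ S, |c i| * K i, fun x => ?_⟩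
  have hdiff : ∀ i ∈ S, ContDiffAt ℝ n (F i) x := fun i hi =>
    ((hF i hi).1.of_le (mod_cast le_top)).contDiffAt
  rw [iteratedFDeriv_fun_sum_apply fun i hi => (hdiff i hi).const_smul (c i)]
  refine (norm_sum_le _ _).trans (Finset.sum_le_sum fun i hi => ?_)
  rw [iteratedFDeriv_const_smul_apply' (hdiff i hi), norm_smul, Real.norm_eq_abs]
  exact mul_le_mul_of_nonneg_left (hK i hi x) (abs_nonneg _)

theorem IsCbSmooth.derivAlong {U f : Euc N → Euc N} (hU : IsCbSmooth U) (hf : IsCbSmooth f) :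
    IsCbSmooth (derivAlong U f) := by
  have hf' : ContDiff ℝ ∞ (fderiv ℝ f) := hf.1.fderiv_right (by simp)
  refine ⟨hf'.clm_apply hU.1, fun n => ?_⟩
  choose KU hKU using hU.2
  choose Kf hKf using hf.2
  refine ⟨∑ i ∈ Finset.range (n + 1), (n.choose i : ℝ) * Kf (i + 1) * KU (n - i), fun x => ?_⟩
  refine (norm_iteratedFDeriv_clm_apply (N := ∞) hf' hU.1 x (mod_cast le_top)).trans
    (Finset.sum_le_sum fun i _ => ?_)
  rw [norm_iteratedFDeriv_fderiv]
  have hKf_nonneg : 0 ≤ Kf (i + 1) := (norm_nonneg _).trans (hKf _ x)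
  gcongr
  · exact hKf _ x
  · exact hKU _ x

theorem IsCbSmooth.bddAbove {W : Euc N → Euc N} (hW : IsCbSmooth W) (i : ℕ) :
    BddAbove (Set.range fun x => ‖iteratedFDeriv ℝ i W x‖) := by
  obtain ⟨K, hK⟩ := hW.2 i
  exact ⟨K, Set.forall_mem_range.mpr hK⟩

theorem cNorm_nonneg (n : ℕ) (W : Euc N → Euc N) : 0 ≤ cNorm n W :=
  Finset.sum_nonneg fun _ _ => Real.iSup_nonneg fun _ => norm_nonneg _

theorem cNorm_mono {k n : ℕ} (h : k ≤ n) (W : Euc N → Euc N) : cNorm k W ≤ cNorm n W :=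
  Finset.sum_le_sum_of_subset_of_nonneg (Finset.range_mono (Nat.succ_le_succ h))
    fun _ _ _ => Real.iSup_nonneg fun _ => norm_nonneg _

theorem IsCbSmooth.norm_iteratedFDeriv_le_cNorm {W : Euc N → Euc N} (hW : IsCbSmooth W) (n : ℕ)
    (x : Euc N) : ‖iteratedFDeriv ℝ n W x‖ ≤ cNorm n W :=
  (le_ciSup (hW.bddAbove n) x).trans
    (Finset.single_le_sum (f := fun i => ⨆ x, ‖iteratedFDeriv ℝ i W x‖)
      (fun _ _ => Real.iSup_nonneg fun _ => norm_nonneg _) (Finset.self_mem_range_succ n))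

theorem IsCbSmooth.norm_le_cNorm {W : Euc N → Euc N} (hW : IsCbSmooth W) (n : ℕ) (x : Euc N) :
    ‖W x‖ ≤ cNorm n W := by
  simpa using (hW.norm_iteratedFDeriv_le_cNorm 0 x).trans (cNorm_mono n.zero_le W)

theorem cNorm_sum_smul_le {ι : Type*} (S : Finset ι) (c : ι → ℝ) {F : ι → Euc N → Euc N}
    (hF : ∀ i ∈ S, IsCbSmooth (F i)) (n : ℕ) :
    cNorm n (fun x => ∑ i ∈ S, c i • F i x) ≤ ∑ i ∈ S, |c i| * cNorm n (F i) := by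
  simp only [cNorm, Finset.mul_sum]
  rw [Finset.sum_comm]
  refine Finset.sum_le_sum fun k _ => ciSup_le fun x => ?_
  have hdiff : ∀ i ∈ S, ContDiffAt ℝ k (F i) x := fun i hi =>
    ((hF i hi).1.of_le (mod_cast le_top)).contDiffAt
  rw [iteratedFDeriv_fun_sum_apply fun i hi => (hdiff i hi).const_smul (c i)]
  refine (norm_sum_le _ _).trans (Finset.sum_le_sum fun i hi => ?_)
  rw [iteratedFDeriv_const_smul_apply' (hdiff i hi), norm_smul, Real.norm_eq_abs]
  exact mul_le_mul_of_nonneg_left (le_ciSup ((hF i hi).bddAbove k) x) (abs_nonneg _)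

theorem IsCbSmooth.lipschitzWith {W : Euc N → Euc N} (hW : IsCbSmooth W) :
    LipschitzWith (cNorm 1 W).toNNReal W := by
  refine lipschitzWith_of_nnnorm_fderiv_le (𝕜 := ℝ) (hW.1.differentiable (by simp)) fun x => ?_
  rw [← norm_toNNReal, ← norm_iteratedFDeriv_one]
  exact Real.toNNReal_le_toNNReal (hW.norm_iteratedFDeriv_le_cNorm 1 x)

end CbSmooth

/-! ### The differential operators of polynomials -/

section DerivAlong

variable {N : ℕ} {F : Type*} [NormedAddCommGroup F] [NormedSpace ℝ F]
  {U W : Euc N → Euc N} {f : Euc N → F}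

theorem contDiff_derivAlong (hU : ContDiff ℝ ∞ U) (hf : ContDiff ℝ ∞ f) :
    ContDiff ℝ ∞ (derivAlong U f) :=
  (hf.fderiv_right (m := ∞) (by simp)).clm_apply hU

theorem derivAlong_id : derivAlong U id = U := by
  funext x; simp [derivAlong]

theorem derivAlong_sum_smul {ι : Type*} (S : Finset ι) (c : ι → ℝ) {f : ι → Euc N → F}
    (hf : ∀ i ∈ S, ContDiff ℝ ∞ (f i)) :
    derivAlong U (∑ i ∈ S, c i • f i) = ∑ i ∈ S, c i • derivAlong U (f i) := by
  funext x
  have hdiff : ∀ i ∈ S, DifferentiableAt ℝ (f i) x := fun i hi =>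
    (hf i hi).differentiable (by simp) x
  rw [derivAlong, fderiv_sum fun i hi => (hdiff i hi).const_smul (c i)]
  simp only [sum_apply, Finset.sum_apply, Pi.smul_apply]
  refine Finset.sum_congr rfl fun i hi => ?_
  rw [fderiv_const_smul (hdiff i hi)]
  rfl

theorem derivAlong_derivAlong (hW : ContDiff ℝ ∞ W) (hf : ContDiff ℝ ∞ f) (x : Euc N) :
    derivAlong U (derivAlong W f) x
      = fderiv ℝ f x (fderiv ℝ W x (U x)) + fderiv ℝ (fderiv ℝ f) x (U x) (W x) := by
  have hf' : DifferentiableAt ℝ (fderiv ℝ f) x :=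
    (hf.fderiv_right (m := ∞) (by simp)).differentiable (by simp) x
  change fderiv ℝ (fun y => fderiv ℝ f y (W y)) x (U x) = _
  rw [fderiv_clm_apply hf' (hW.differentiable (by simp) x)]
  simp

theorem derivAlong_derivAlong_sub_derivAlong_derivAlong (hU : ContDiff ℝ ∞ U)
    (hW : ContDiff ℝ ∞ W) (hf : ContDiff ℝ ∞ f) :
    derivAlong U (derivAlong W f) - derivAlong W (derivAlong U f)
      = derivAlong (derivAlong U W - derivAlong W U) f := by
  funext x
  have hsymm : IsSymmSndFDerivAt ℝ f x :=
    hf.contDiffAt.isSymmSndFDerivAt (by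
      rw [minSmoothness_of_isRCLikeNormedField]
      exact WithTop.coe_le_coe.mpr (le_top : (2 : ℕ∞) ≤ ⊤))
  rw [Pi.sub_apply, derivAlong_derivAlong hW hf, derivAlong_derivAlong hU hf, hsymm (W x) (U x)]
  simp [derivAlong]

end DerivAlong

section Phi

open NCSeries

variable {N d : ℕ} {F : Type*} [NormedAddCommGroup F] [NormedSpace ℝ F]
  {V : Fin (d + 1) → Euc N → Euc N}

theorem wordOp_append (u v : Word d) (f : Euc N → F) :
    wordOp V (u ++ v) f = wordOp V u (wordOp V v f) := by
  simp [wordOp, List.foldr_append]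

theorem contDiff_wordOp (hV : ∀ i, ContDiff ℝ ∞ (V i)) (w : Word d) {f : Euc N → F}
    (hf : ContDiff ℝ ∞ f) : ContDiff ℝ ∞ (wordOp V w f) := by
  induction w with
  | nil => exact hf
  | cons i w ih => exact contDiff_derivAlong (hV i) ih

theorem wordOp_sum_smul (hV : ∀ i, ContDiff ℝ ∞ (V i)) (w : Word d) {ι : Type*} (S : Finset ι)
    (c : ι → ℝ) {f : ι → Euc N → F} (hf : ∀ i ∈ S, ContDiff ℝ ∞ (f i)) :
    wordOp V w (∑ i ∈ S, c i • f i) = ∑ i ∈ S, c i • wordOp V w (f i) := by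
  induction w with
  | nil => rfl
  | cons a w ih =>
    change derivAlong (V a) (wordOp V w (∑ i ∈ S, c i • f i)) = _
    rw [ih, derivAlong_sum_smul S c fun i hi => contDiff_wordOp hV w (hf i hi)]
    rfl

theorem IsCbSmooth.wordOp_id (hV : ∀ i, IsCbSmooth (V i)) {w : Word d} (hw : w ≠ []) :
    IsCbSmooth (wordOp V w (id : Euc N → Euc N)) := by
  induction w with
  | nil => exact absurd rfl hw
  | cons i w ih =>
    rcases eq_or_ne w [] with rfl | h
    · rw [show wordOp V [i] id = V i from derivAlong_id]; exact hV i
    · exact (hV i).derivAlong (ih h)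

/-- `P ↦ Φ(j_n P) f` as a linear map, which is `P ↦ Φ(P) f` on the polynomials of weight at most
`n`. -/
def phiOpTruncated (V : Fin (d + 1) → Euc N → Euc N) (n : ℕ) (f : Euc N → F) :
    NCSeries d →ₗ[ℝ] (Euc N → F) :=
  ∑ w ∈ wordsLE d n, (coeff w).smulRight (wordOp V w f)

theorem phiOpTruncated_apply (n : ℕ) (f : Euc N → F) (P : NCSeries d) :
    phiOpTruncated V n f P = ∑ w ∈ wordsLE d n, coeff w P • wordOp V w f := by
  simp [phiOpTruncated]

theorem phiOp_eq_phiOpTruncated {n : ℕ} {P : NCSeries d} (hP : P ∈ weightLE d n) (f : Euc N → F) :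
    phiOp V P f = phiOpTruncated V n f P := by
  funext x
  rw [phiOpTruncated_apply, Finset.sum_apply]
  refine finsum_eq_sum_of_support_subset _ fun w hw => ?_
  by_contra h
  rw [Finset.mem_coe, mem_wordsLE, not_le] at h
  exact hw (by change coeff w P • _ = _; rw [hP w h, zero_smul])

theorem phiOp_zero_left (f : Euc N → F) : phiOp V (0 : NCSeries d) f = 0 := by
  rw [phiOp_eq_phiOpTruncated (zero_mem (weightLE d 0)), map_zero]

theorem phiOp_add {n : ℕ} {P Q : NCSeries d} (hP : P ∈ weightLE d n) (hQ : Q ∈ weightLE d n)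
    (f : Euc N → F) : phiOp V (P + Q : NCSeries d) f = phiOp V P f + phiOp V Q f := by
  rw [phiOp_eq_phiOpTruncated hP, phiOp_eq_phiOpTruncated hQ,
    phiOp_eq_phiOpTruncated (add_mem hP hQ), map_add]

theorem phiOp_sub {n : ℕ} {P Q : NCSeries d} (hP : P ∈ weightLE d n) (hQ : Q ∈ weightLE d n)
    (f : Euc N → F) : phiOp V (P - Q : NCSeries d) f = phiOp V P f - phiOp V Q f := by
  rw [phiOp_eq_phiOpTruncated hP, phiOp_eq_phiOpTruncated hQ,
    phiOp_eq_phiOpTruncated (sub_mem hP hQ), map_sub]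

theorem phiOp_smul {n : ℕ} {P : NCSeries d} (hP : P ∈ weightLE d n) (c : ℝ) (f : Euc N → F) :
    phiOp V (c • P : NCSeries d) f = c • phiOp V P f := by
  rw [phiOp_eq_phiOpTruncated hP, phiOp_eq_phiOpTruncated ((weightLE d n).smul_mem c hP), map_smul]

theorem phiOp_sum {n : ℕ} {ι : Type*} (S : Finset ι) {P : ι → NCSeries d}
    (hP : ∀ i ∈ S, P i ∈ weightLE d n) (f : Euc N → F) :
    phiOp V (∑ i ∈ S, P i : NCSeries d) f = ∑ i ∈ S, phiOp V (P i) f := by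
  rw [phiOp_eq_phiOpTruncated (sum_mem hP), map_sum]
  exact Finset.sum_congr rfl fun i hi => (phiOp_eq_phiOpTruncated (hP i hi) f).symm

theorem contDiff_phiOp (hV : ∀ i, ContDiff ℝ ∞ (V i)) {n : ℕ} {P : NCSeries d}
    (hP : P ∈ weightLE d n) {f : Euc N → F} (hf : ContDiff ℝ ∞ f) : ContDiff ℝ ∞ (phiOp V P f) := by
  rw [phiOp_eq_phiOpTruncated hP, phiOpTruncated_apply]
  convert ContDiff.sum fun w _ => (contDiff_wordOp hV w hf).const_smul (coeff w P)
  exact Finset.sum_apply _ _ _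

theorem phiOp_one (f : Euc N → F) : phiOp V (1 : NCSeries d) f = f := by
  rw [phiOp_eq_phiOpTruncated (one_mem_weightLE 0), phiOpTruncated_apply,
    Finset.sum_eq_single []]
  · rw [coeff_one, if_pos rfl, one_smul]; rfl
  · intro w _ hw; rw [coeff_one, if_neg hw, zero_smul]
  · intro h; exact absurd (mem_wordsLE.mpr weight_nil.le) h

theorem phiOp_letter (i : Fin (d + 1)) (f : Euc N → F) :
    phiOp V (letter i) f = derivAlong (V i) f := by
  funext x
  refine (finsum_eq_single _ [i] fun w hw => ?_).trans ?_
  · rw [letter, if_neg hw, zero_smul]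
  · rw [letter, if_pos rfl, one_smul]; rfl

theorem sum_wordsLE_sum_take_drop {A : Type*} [AddCommMonoid A] (n : ℕ)
    (G : Word d → Word d → A) :
    ∑ w ∈ wordsLE d n, ∑ k ∈ Finset.range (w.length + 1), G (w.take k) (w.drop k)
      = ∑ p ∈ wordsLE d n ×ˢ wordsLE d n with weight p.1 + weight p.2 ≤ n, G p.1 p.2 := by
  rw [Finset.sum_sigma']
  refine Finset.sum_bij' (fun x _ => (x.1.take x.2, x.1.drop x.2))
    (fun p _ => ⟨p.1 ++ p.2, p.1.length⟩) ?_ ?_ ?_ ?_ ?_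
  · rintro ⟨w, k⟩ h
    have := weight_take_add_weight_drop w k
    simp only [Finset.mem_sigma, Finset.mem_filter, Finset.mem_product, mem_wordsLE] at h ⊢
    omega
  · rintro ⟨u, v⟩ h
    simpa [mem_wordsLE, weight_append] using (Finset.mem_filter.mp h).2
  · rintro ⟨w, k⟩ h
    have hk : k ≤ w.length := Nat.lt_succ_iff.mp (Finset.mem_range.mp (Finset.mem_sigma.mp h).2)
    simp [hk]
  · simp
  · simp

theorem phiOp_mul (hV : ∀ i, ContDiff ℝ ∞ (V i)) {i j : ℕ} {P Q : NCSeries d}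
    (hP : P ∈ weightLE d i) (hQ : Q ∈ weightLE d j) {f : Euc N → F} (hf : ContDiff ℝ ∞ f) :
    phiOp V (P * Q : NCSeries d) f = phiOp V P (phiOp V Q f) := by
  let G (u v : Word d) : Euc N → F := coeff u P • coeff v Q • wordOp V u (wordOp V v f)
  calc phiOp V (P * Q : NCSeries d) f
      = ∑ w ∈ wordsLE d (i + j), ∑ k ∈ Finset.range (w.length + 1), G (w.take k) (w.drop k) := by
        rw [phiOp_eq_phiOpTruncated (mul_mem_weightLE_add hP hQ), phiOpTruncated_apply]
        refine Finset.sum_congr rfl fun w _ => ?_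
        rw [coeff_mul, Finset.sum_smul]
        refine Finset.sum_congr rfl fun k _ => ?_
        simp only [G]
        rw [mul_smul, ← wordOp_append, List.take_append_drop]
    _ = ∑ p ∈ wordsLE d i ×ˢ wordsLE d j, G p.1 p.2 := by
        rw [sum_wordsLE_sum_take_drop]
        refine (Finset.sum_subset (fun p hp => ?_) fun p _ hp => ?_).symm
        · simp only [Finset.mem_product, Finset.mem_filter, mem_wordsLE] at hp ⊢
          omega
        · simp only [Finset.mem_product, mem_wordsLE, not_and_or, not_le] at hp
          rcases hp with h | h
          · simp only [G, hP _ h, zero_smul]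
          · simp only [G, hQ _ h, zero_smul, smul_zero]
    _ = phiOp V P (phiOp V Q f) := by
        rw [Finset.sum_product, phiOp_eq_phiOpTruncated hP, phiOpTruncated_apply,
          phiOp_eq_phiOpTruncated hQ, phiOpTruncated_apply]
        refine Finset.sum_congr rfl fun u _ => ?_
        rw [wordOp_sum_smul hV u _ _ fun v _ => contDiff_wordOp hV v hf, Finset.smul_sum]

theorem phiOp_sBracket (hV : ∀ i, ContDiff ℝ ∞ (V i)) {i j : ℕ} {P Q : NCSeries d}
    (hP : P ∈ weightLE d i) (hQ : Q ∈ weightLE d j) {f : Euc N → F} (hf : ContDiff ℝ ∞ f) :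
    phiOp V (sBracket P Q) f = phiOp V P (phiOp V Q f) - phiOp V Q (phiOp V P f) := by
  have hPQ := mul_mem_weightLE_add hP hQ
  have hQP := mul_mem_weightLE_add hQ hP
  rw [← phiOp_mul hV hP hQ hf, ← phiOp_mul hV hQ hP hf]
  exact phiOp_sub hPQ (add_comm i j ▸ hQP) f

theorem exists_mem_weightLE_of_mem_liePoly {P : NCSeries d} (hP : P ∈ liePoly d) :
    ∃ n, P ∈ weightLE d n := by
  induction (hP : IsLiePolynomial P) with
  | letter i =>
    refine ⟨weight [i], fun w hw => if_neg ?_⟩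
    rintro rfl
    exact lt_irrefl _ hw
  | zero => exact ⟨0, zero_mem _⟩
  | add _ _ ihP ihQ =>
    obtain ⟨⟨i, hi⟩, j, hj⟩ := ihP, ihQ
    exact ⟨max i j,
      add_mem (weightLE_mono (le_max_left i j) hi) (weightLE_mono (le_max_right i j) hj)⟩
  | smul c _ ih =>
    obtain ⟨i, hi⟩ := ih
    exact ⟨i, (weightLE d i).smul_mem c hi⟩
  | bracket _ _ ihP ihQ =>
    obtain ⟨⟨i, hi⟩, j, hj⟩ := ihP, ihQ
    exact ⟨i + j, sub_mem (mul_mem_weightLE_add hi hj) (add_comm i j ▸ mul_mem_weightLE_add hj hi)⟩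

theorem phiOp_zero_right (hV : ∀ i, ContDiff ℝ ∞ (V i)) (P : NCSeries d) :
    phiOp V P (0 : Euc N → F) = 0 := by
  have hword (w : Word d) : wordOp V w (0 : Euc N → F) = 0 := by
    simpa using wordOp_sum_smul hV w ∅ (0 : ℕ → ℝ) (f := 0) (by simp)
  funext x
  simp [phiOp, hword]

theorem phiOp_homogeneousComponent_mul (hV : ∀ i, ContDiff ℝ ∞ (V i)) (P Q : NCSeries d) (k : ℕ)
    {f : Euc N → F} (hf : ContDiff ℝ ∞ f) :
    phiOp V (homogeneousComponent k (P * Q)) f = ∑ p ∈ antidiagonal k,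
      phiOp V (homogeneousComponent p.1 P) (phiOp V (homogeneousComponent p.2 Q) f) := by
  have hmem : ∀ p ∈ antidiagonal k,
      homogeneousComponent p.1 P * homogeneousComponent p.2 Q ∈ weightLE d k := fun p hp =>
    mem_antidiagonal.mp hp ▸ mul_mem_weightLE_add (homogeneousComponent_mem_weightLE _ P)
      (homogeneousComponent_mem_weightLE _ Q)
  rw [homogeneousComponent_mul, phiOp_sum _ hmem]
  exact Finset.sum_congr rfl fun p _ => phiOp_mul hV (homogeneousComponent_mem_weightLE _ P)
    (homogeneousComponent_mem_weightLE _ Q) hf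

theorem eq_zero_of_sum_pow_mul_eq_zero {n : ℕ} {a : ℕ → ℝ} {S : Set ℝ} (hS : S.Infinite)
    (h : ∀ t ∈ S, ∑ k ∈ Finset.range n, t ^ k * a k = 0) {k : ℕ} (hk : k < n) : a k = 0 := by
  let p : Polynomial ℝ := ∑ k ∈ Finset.range n, Polynomial.monomial k (a k)
  have hp : p = 0 := Polynomial.eq_zero_of_infinite_isRoot p <| hS.mono fun t ht => by
    simpa [p, Polynomial.eval_finsetSum, mul_comm] using h t ht
  have hcoeff : p.coeff k = a k := by
    simp [p, Polynomial.coeff_monomial, hk]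
  rw [← hcoeff, hp, Polynomial.coeff_zero]

theorem phiOp_eq_derivAlong_phiField (hV : ∀ i, ContDiff ℝ ∞ (V i)) {P : NCSeries d}
    (hP : P ∈ liePoly d) {f : Euc N → Euc N} (hf : ContDiff ℝ ∞ f) :
    phiOp V P f = derivAlong (phiField V P) f := by
  induction (hP : IsLiePolynomial P) generalizing f with
  | letter i => rw [phiField, phiOp_letter, phiOp_letter, derivAlong_id]
  | zero =>
    have hzero (g : Euc N → Euc N) : phiOp V (0 : Series d) g = 0 := phiOp_zero_left g
    rw [phiField, hzero, hzero]
    funext x; simp [derivAlong]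
  | @add P Q hP hQ ihP ihQ =>
    obtain ⟨i, hi⟩ := exists_mem_weightLE_of_mem_liePoly hP
    obtain ⟨j, hj⟩ := exists_mem_weightLE_of_mem_liePoly hQ
    have hadd (g : Euc N → Euc N) : phiOp V (P + Q : Series d) g = phiOp V P g + phiOp V Q g :=
      phiOp_add (weightLE_mono (le_max_left i j) hi) (weightLE_mono (le_max_right i j) hj) g
    rw [phiField, hadd, hadd, ihP hf, ihQ hf]
    funext x; simp [derivAlong, phiField]
  | @smul c P hP ih =>
    obtain ⟨i, hi⟩ := exists_mem_weightLE_of_mem_liePoly hP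
    have hsmul (g : Euc N → Euc N) : phiOp V (c • P : Series d) g = c • phiOp V P g :=
      phiOp_smul hi c g
    rw [phiField, hsmul, hsmul, ih hf]
    funext x; simp [derivAlong, phiField]
  | @bracket P Q hP hQ ihP ihQ =>
    obtain ⟨i, hi⟩ := exists_mem_weightLE_of_mem_liePoly hP
    obtain ⟨j, hj⟩ := exists_mem_weightLE_of_mem_liePoly hQ
    have hU : ContDiff ℝ ∞ (phiField V P) := contDiff_phiOp hV hi contDiff_id
    have hW : ContDiff ℝ ∞ (phiField V Q) := contDiff_phiOp hV hj contDiff_id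
    have hbracket {g : Euc N → Euc N} (hg : ContDiff ℝ ∞ g) : phiOp V (sBracket P Q) g
        = derivAlong (derivAlong (phiField V P) (phiField V Q)
          - derivAlong (phiField V Q) (phiField V P)) g := by
      rw [phiOp_sBracket hV hi hj hg, ihP (contDiff_phiOp hV hj hg),
        ihQ (contDiff_phiOp hV hi hg), ihP hg, ihQ hg,
        derivAlong_derivAlong_sub_derivAlong_derivAlong hU hW hg]
    rw [phiField, hbracket contDiff_id, derivAlong_id, hbracket hf]

theorem phiField_dilation {n : ℕ} {P : NCSeries d} (hP : P ∈ weightLE d n) (t : ℝ) :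
    phiField V (dilation t P)
      = ∑ k ∈ Finset.range (n + 1), t ^ k • phiField V (homogeneousComponent k P) := by
  have hcomp : ∀ k ∈ Finset.range (n + 1), homogeneousComponent k P ∈ weightLE d n := fun k hk =>
    weightLE_mono (Nat.lt_succ_iff.mp (Finset.mem_range.mp hk))
      (homogeneousComponent_mem_weightLE k P)
  have hsum : dilation t P = ∑ k ∈ Finset.range (n + 1), t ^ k • homogeneousComponent k P := by
    simp only [← homogeneousComponent_dilation]
    rw [sum_homogeneousComponent (dilation_mem_weightLE hP t)]
  rw [hsum]
  exact (phiOp_sum _ (fun k hk => (weightLE d n).smul_mem _ (hcomp k hk)) id).trans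
    (Finset.sum_congr rfl fun k hk => phiOp_smul (hcomp k hk) _ id)

/-- The series all of whose homogeneous components are mapped to `0` by `Φ`. It stands for the
kernel of `Φ` on series, where `Φ` itself is not defined. -/
def nullIdeal (V : Fin (d + 1) → Euc N → Euc N) (hV : ∀ i, ContDiff ℝ ∞ (V i)) :
    Ideal (NCSeries d) where
  carrier := {P | ∀ k (f : Euc N → Euc N), ContDiff ℝ ∞ f →
    phiOp V (homogeneousComponent k P) f = 0}
  add_mem' {P Q} hP hQ k f hf := by
    rw [map_add, phiOp_add (homogeneousComponent_mem_weightLE k P)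
      (homogeneousComponent_mem_weightLE k Q), hP k f hf, hQ k f hf, add_zero]
  zero_mem' k f _ := by rw [map_zero, phiOp_zero_left]
  smul_mem' Q P hP k f hf := by
    rw [smul_eq_mul, phiOp_homogeneousComponent_mul hV Q P k hf]
    exact Finset.sum_eq_zero fun p _ => by rw [hP p.2 f hf, phiOp_zero_right hV]

section NullIdeal

variable {hV : ∀ i, ContDiff ℝ ∞ (V i)}

instance : (nullIdeal V hV).IsTwoSided where
  mul_mem_of_left {P} Q hP k f hf := by
    rw [phiOp_homogeneousComponent_mul hV P Q k hf]
    exact Finset.sum_eq_zero fun p _ =>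
      hP p.1 _ (contDiff_phiOp hV (homogeneousComponent_mem_weightLE p.2 Q) hf)

theorem isWeightClosed_nullIdeal : IsWeightClosed (nullIdeal V hV) := fun P h k f hf => by
  obtain ⟨Q, hQ, hPQ⟩ := h (k + 1)
  rw [homogeneousComponent_eq_of_smodEq k.lt_succ_self hPQ, hQ k f hf]

theorem phiField_dilation_truncation_eq {P Q : NCSeries d} (h : P ≡ Q [SMOD nullIdeal V hV])
    (m : ℕ) (t : ℝ) :
    phiField V (dilation t (truncation m P)) = phiField V (dilation t (truncation m Q)) := by
  rw [phiField_dilation (truncation_mem_weightLE m P),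
    phiField_dilation (truncation_mem_weightLE m Q)]
  refine Finset.sum_congr rfl fun k hk => ?_
  have hkm : k ≤ m := Nat.lt_succ_iff.mp (Finset.mem_range.mp hk)
  rw [homogeneousComponent_truncation, homogeneousComponent_truncation, if_pos hkm, if_pos hkm]
  have hsub : phiField V (homogeneousComponent k P) - phiField V (homogeneousComponent k Q)
      = phiOp V (homogeneousComponent k (P - Q)) id := by
    rw [map_sub]
    exact (phiOp_sub (homogeneousComponent_mem_weightLE k P)
      (homogeneousComponent_mem_weightLE k Q) id).symm
  rw [sub_eq_zero.mp (hsub.trans (SModEq.sub_mem.mp h k id contDiff_id))]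

theorem mem_nullIdeal_of_phiField_dilation_eq_zero {n : ℕ} {P : NCSeries d} (hP : P ∈ lieSeries d)
    (hPn : P ∈ weightLE d n) {S : Set ℝ} (hS : S.Infinite)
    (h : ∀ t ∈ S, phiField V (dilation t P) = 0) : P ∈ nullIdeal V hV := by
  intro k f hf
  have hfield : phiField V (homogeneousComponent k P) = 0 := by
    rcases lt_or_ge n k with hk | hk
    · have hcomp : homogeneousComponent k P = 0 := by
        rw [← truncation_eq_self hPn, homogeneousComponent_truncation, if_neg hk.not_ge]
      rw [hcomp]
      exact phiOp_zero_left id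
    · ext x i
      refine eq_zero_of_sum_pow_mul_eq_zero (n := n + 1) hS (fun t ht => ?_)
        (Nat.lt_succ_iff.mpr hk) (a := fun k => phiField V (homogeneousComponent k P) x i)
      simpa [phiField_dilation hPn] using congrArg (fun W : Euc N → Euc N => W x i) (h t ht)
  rw [phiOp_eq_derivAlong_phiField hV (hP k) hf, hfield]
  funext x; simp [derivAlong]

end NullIdeal

end Phi

section Phi

open NCSeries

variable {N d : ℕ} {V : Fin (d + 1) → Euc N → Euc N}

theorem phiField_eq_sum {n : ℕ} {P : NCSeries d} (hP : P ∈ weightLE d n) (hP1 : P ∈ weightGE d 1) :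
    phiField V P = fun x => ∑ w ∈ (wordsLE d n).erase [], coeff w P • wordOp V w id x := by
  have hsum : phiField V P = ∑ w ∈ wordsLE d n, coeff w P • wordOp V w id :=
    (phiOp_eq_phiOpTruncated hP id).trans (phiOpTruncated_apply n id P)
  rw [hsum, ← Finset.sum_erase _ (a := [])]
  · funext x
    simp only [Finset.sum_apply, Pi.smul_apply]
  · rw [mem_weightGE_one_iff.mp hP1, zero_smul]

theorem isCbSmooth_phiField (hV : ∀ i, IsCbSmooth (V i)) {n : ℕ} {P : NCSeries d}
    (hP : P ∈ weightLE d n) (hP1 : P ∈ weightGE d 1) : IsCbSmooth (phiField V P) := by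
  rw [phiField_eq_sum hP hP1]
  exact .sum_smul _ _ fun w hw => .wordOp_id hV (Finset.ne_of_mem_erase hw)

theorem cNorm_phiField_le (hV : ∀ i, IsCbSmooth (V i)) {n : ℕ} {P : NCSeries d}
    (hP : P ∈ weightLE d n) (hP1 : P ∈ weightGE d 1) (k : ℕ) :
    cNorm k (phiField V P)
      ≤ ∑ w ∈ (wordsLE d n).erase [], |coeff w P| * cNorm k (wordOp V w (id : Euc N → Euc N)) := by
  rw [phiField_eq_sum hP hP1]
  exact cNorm_sum_smul_le _ _ (fun w hw => .wordOp_id hV (Finset.ne_of_mem_erase hw)) k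

end Phi

/-! ### Flows -/

section Flow

variable {N : ℕ} {W : Euc N → Euc N}

theorem IsCbSmooth.exists_isSolution (hW : IsCbSmooth W) (x : Euc N) : ∃ z, IsSolution W x z := by
  have h : IsPicardLindelof (fun _ => W) (tmin := 0) (tmax := 1) ⟨0, by simp⟩ x
      (cNorm 1 W).toNNReal 0 (cNorm 1 W).toNNReal (cNorm 1 W).toNNReal := by
    refine .of_time_independent (fun y _ => ?_) hW.lipschitzWith.lipschitzOnWith (by simp)
    rw [Real.coe_toNNReal _ (cNorm_nonneg _ _)]
    exact hW.norm_le_cNorm 1 y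
  exact h.exists_eq_forall_mem_Icc_hasDerivWithinAt₀

theorem IsCbSmooth.exists_isSolution_flowExp_eq (hW : IsCbSmooth W) (x : Euc N) :
    ∃ z, IsSolution W x z ∧ flowExp W x = z 1 := by
  have h := hW.exists_isSolution x
  exact ⟨h.choose, h.choose_spec, by rw [flowExp, dif_pos h]⟩

theorem IsSolution.continuousOn {x : Euc N} {z : ℝ → Euc N} (hz : IsSolution W x z) :
    ContinuousOn z (Set.Icc 0 1) :=
  fun t ht => (hz.2 t ht).continuousWithinAt

theorem IsSolution.hasDerivWithinAt_Ici {x : Euc N} {z : ℝ → Euc N} (hz : IsSolution W x z) {t : ℝ}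
    (ht : t ∈ Set.Ico (0 : ℝ) 1) : HasDerivWithinAt z (W (z t)) (Set.Ici t) t :=
  (hz.2 t (Set.Ico_subset_Icc_self ht)).mono_of_mem_nhdsWithin
    (Filter.mem_of_superset (Icc_mem_nhdsGE ht.2) (Set.Icc_subset_Icc_left ht.1))

theorem IsCbSmooth.norm_flowExp_sub_flowExp_le (hW : IsCbSmooth W) (x y : Euc N) :
    ‖flowExp W x - flowExp W y‖ ≤ Real.exp (cNorm 1 W) * ‖x - y‖ := by
  obtain ⟨z, hz, hzx⟩ := hW.exists_isSolution_flowExp_eq x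
  obtain ⟨u, hu, huy⟩ := hW.exists_isSolution_flowExp_eq y
  have h := dist_le_of_trajectories_ODE (v := fun _ => W) (δ := ‖x - y‖) (fun _ => hW.lipschitzWith)
    hz.continuousOn (fun t => hz.hasDerivWithinAt_Ici) hu.continuousOn
    (fun t => hu.hasDerivWithinAt_Ici) (by rw [hz.1, hu.1, dist_eq_norm]) 1 (by simp)
  rw [Real.coe_toNNReal _ (cNorm_nonneg _ _), sub_zero, mul_one, mul_comm] at h
  rwa [hzx, huy, ← dist_eq_norm]

end Flow

section Taylor

variable {E : Type*} [NormedAddCommGroup E] [NormedSpace ℝ E]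

theorem hasDerivAt_sum_pow_mul_inv_factorial_smul (n : ℕ) (a : ℕ → E) (t : ℝ) :
    HasDerivAt (fun t : ℝ => ∑ k ∈ Finset.range (n + 1), (t ^ k * (k.factorial : ℝ)⁻¹) • a k)
      (∑ k ∈ Finset.range n, (t ^ k * (k.factorial : ℝ)⁻¹) • a (k + 1)) t := by
  have hsum : ∑ k ∈ Finset.range n, (t ^ k * (k.factorial : ℝ)⁻¹) • a (k + 1)
      = ∑ k ∈ Finset.range (n + 1), ((k : ℝ) * t ^ (k - 1) * (k.factorial : ℝ)⁻¹) • a k := by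
    rw [Finset.sum_range_succ' _ n]
    simp only [Nat.cast_zero, zero_mul, zero_smul, add_zero]
    refine Finset.sum_congr rfl fun k _ => congrArg (· • a (k + 1)) ?_
    rw [Nat.factorial_succ, Nat.add_sub_cancel]
    push_cast
    field_simp
  rw [hsum]
  exact HasDerivAt.fun_sum fun k _ => ((hasDerivAt_pow k t).mul_const _).smul_const _

theorem norm_sub_taylor_le {C : ℝ} (n : ℕ) (h : ℕ → ℝ → E)
    (hd : ∀ k < n, ∀ t ∈ Set.Icc (0 : ℝ) 1, HasDerivWithinAt (h k) (h (k + 1) t) (Set.Icc 0 1) t)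
    (hC : ∀ t ∈ Set.Icc (0 : ℝ) 1, ‖h n t‖ ≤ C) :
    ∀ t ∈ Set.Icc (0 : ℝ) 1,
      ‖h 0 t - ∑ k ∈ Finset.range n, (t ^ k * (k.factorial : ℝ)⁻¹) • h k 0‖ ≤ C := by
  induction n generalizing h with
  | zero => simpa using hC
  | succ n ih =>
    intro t ht
    let remainder (t : ℝ) : E :=
      h 0 t - ∑ k ∈ Finset.range (n + 1), (t ^ k * (k.factorial : ℝ)⁻¹) • h k 0
    have hderiv : ∀ t ∈ Set.Icc (0 : ℝ) 1, HasDerivWithinAt remainder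
        (h 1 t - ∑ k ∈ Finset.range n, (t ^ k * (k.factorial : ℝ)⁻¹) • h (k + 1) 0)
        (Set.Icc 0 1) t := fun t ht =>
      (hd 0 n.succ_pos t ht).sub
        (hasDerivAt_sum_pow_mul_inv_factorial_smul n (h · 0) t).hasDerivWithinAt
    have hbound := ih (fun k => h (k + 1)) (fun k hk => hd (k + 1) (by omega)) hC
    have hmvt := norm_image_sub_le_of_norm_deriv_le_segment' hderiv
      (fun s hs => hbound s (Set.Ico_subset_Icc_self hs)) t ht
    have hzero : remainder 0 = 0 := by simp [remainder, Finset.sum_range_succ']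
    have hC0 : 0 ≤ C := (norm_nonneg _).trans (hC 0 (by simp))
    rw [hzero, sub_zero, sub_zero] at hmvt
    exact hmvt.trans (mul_le_of_le_one_right hC0 ht.2)

end Taylor

theorem IsCbSmooth.norm_flowExp_sub_self_le {N : ℕ} {W : Euc N → Euc N} (hW : IsCbSmooth W)
    (n : ℕ) (x : Euc N) : ‖flowExp W x - x‖ ≤ cNorm n W := by
  obtain ⟨z, hz, hzx⟩ := hW.exists_isSolution_flowExp_eq x
  have h := norm_image_sub_le_of_norm_deriv_le_segment' hz.2
    (fun t _ => hW.norm_le_cNorm n (z t)) 1 (by simp)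
  rwa [sub_zero, mul_one, hz.1, ← hzx] at h

section PhiFlow

open NCSeries

variable {N d : ℕ} {V : Fin (d + 1) → Euc N → Euc N}

theorem norm_phiField_flowExp_sub_le (hV : ∀ i, IsCbSmooth (V i)) {i j : ℕ} {L Q : NCSeries d}
    (hL : L ∈ lieSeries d) (hLi : L ∈ weightLE d i) (hQ : Q ∈ weightLE d j) (n : ℕ) {C : ℝ}
    (hC : ∀ y, ‖phiField V (L ^ n * Q) y‖ ≤ C) (x : Euc N) :
    ‖phiField V Q (flowExp (phiField V L) x)
      - phiField V ((∑ k ∈ Finset.range n, divPow k L) * Q) x‖ ≤ C := by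
  have hVsmooth : ∀ i, ContDiff ℝ ∞ (V i) := fun i => (hV i).1
  have hmem (k : ℕ) : L ^ k * Q ∈ weightLE d (k * i + j) :=
    mul_mem_weightLE_add (pow_mem_weightLE hLi k) hQ
  have hsmooth (k : ℕ) : ContDiff ℝ ∞ (phiField V (L ^ k * Q)) :=
    contDiff_phiOp hVsmooth (hmem k) contDiff_id
  have hsucc (k : ℕ) : phiField V (L ^ (k + 1) * Q)
      = derivAlong (phiField V L) (phiField V (L ^ k * Q)) := by
    rw [pow_succ', mul_assoc]
    exact (phiOp_mul hVsmooth hLi (hmem k) contDiff_id).trans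
      (phiOp_eq_derivAlong_phiField hVsmooth (mem_liePoly_of_mem_weightLE hL hLi) (hsmooth k))
  have hL1 : L ∈ weightGE d 1 := mem_weightGE_one_of_mem_lieSeries hL
  obtain ⟨z, hz, hzx⟩ := (isCbSmooth_phiField hV hLi hL1).exists_isSolution_flowExp_eq x
  have hderiv (k : ℕ) (t : ℝ) (ht : t ∈ Set.Icc (0 : ℝ) 1) : HasDerivWithinAt
      (fun t => phiField V (L ^ k * Q) (z t)) (phiField V (L ^ (k + 1) * Q) (z t))
      (Set.Icc 0 1) t := by
    rw [hsucc]
    exact ((hsmooth k).differentiable (by simp) _).hasFDerivAt.comp_hasDerivWithinAt t (hz.2 t ht)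
  have hsum : phiField V ((∑ k ∈ Finset.range n, divPow k L) * Q)
      = ∑ k ∈ Finset.range n, (k.factorial : ℝ)⁻¹ • phiField V (L ^ k * Q) := by
    rw [Finset.sum_mul]
    simp only [divPow, smul_mul_assoc]
    refine (phiOp_sum (n := n * i + j) _ (fun k hk => Submodule.smul_mem _ _ (weightLE_mono ?_
      (hmem k))) id).trans (Finset.sum_congr rfl fun k _ => phiOp_smul (hmem k) _ id)
    gcongr
    exact (Finset.mem_range.mp hk).le
  have htaylor := norm_sub_taylor_le n (fun k t => phiField V (L ^ k * Q) (z t))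
    (fun k _ => hderiv k) (fun t _ => hC _) 1 (by simp)
  simpa [hsum, hzx, hz.1] using htaylor

end PhiFlow

/-! ### Asymptotics of families -/

section Asymptotics

open Asymptotics Filter NCSeries

variable {ι : Type*} {l : Filter ι} {d : ℕ}

/-- Each coefficient of `P i` is `O(ρ i)` along `l`, without uniformity over the words. -/
def CoeffIsBigO (l : Filter ι) (P : ι → NCSeries d) (ρ : ι → ℝ) : Prop :=
  ∀ w, (fun i => coeff w (P i)) =O[l] ρ

/-- The algebra of the families of series each of whose coefficients is bounded along `l`. -/
def coeffBounded (d : ℕ) (l : Filter ι) : Subalgebra ℝ (ι → NCSeries d) where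
  carrier := {P | CoeffIsBigO l P fun _ => 1}
  mul_mem' {P Q} hP hQ w := by
    simp only [Pi.mul_apply, coeff_mul]
    exact .fun_sum fun k _ => by simpa using (hP (w.take k)).mul (hQ (w.drop k))
  add_mem' hP hQ w := by simpa using (hP w).add (hQ w)
  algebraMap_mem' c w := by
    simpa using isBigO_const_const (coeff w (algebraMap ℝ (NCSeries d) c)) (one_ne_zero (α := ℝ)) l

theorem truncation_mem_coeffBounded {P : ι → NCSeries d} (hP : P ∈ coeffBounded d l) (m : ℕ) :
    (fun i => truncation m (P i)) ∈ coeffBounded d l := fun w => by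
  by_cases hw : weight w ≤ m
  · simpa only [coeff_truncation, if_pos hw] using hP w
  · simpa only [coeff_truncation, if_neg hw] using isBigO_zero _ l

theorem exp_mem_coeffBounded {P : ι → NCSeries d} (hP : P ∈ coeffBounded d l) :
    (fun i => exp (P i)) ∈ coeffBounded d l := fun w => by
  simp only [coeff_exp]
  exact .fun_sum fun k _ => (pow_mem hP k w).const_mul_left _

theorem log_mem_coeffBounded {P : ι → NCSeries d} (hP : P ∈ coeffBounded d l) :
    (fun i => log (P i)) ∈ coeffBounded d l := fun w => by
  simp only [coeff_log]
  exact .fun_sum fun k _ => (pow_mem (sub_mem hP (one_mem _)) (k + 1) w).const_mul_left _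

theorem expProd_mem_coeffBounded {κ : Type*} {P : κ → ι → NCSeries d}
    (hP : ∀ j, P j ∈ coeffBounded d l) (js : List κ) :
    (fun i => expProd (js.map fun j => P j i)) ∈ coeffBounded d l := by
  induction js with
  | nil => exact one_mem _
  | cons j js ih => exact mul_mem (exp_mem_coeffBounded (hP j)) ih

theorem CoeffIsBigO.dilation_of_mem_weightGE {P : ι → NCSeries d} {t ρ : ι → ℝ}
    (hP : CoeffIsBigO l P ρ) (ht : t =O[l] fun _ => (1 : ℝ)) {n : ℕ}
    (hn : ∀ i, P i ∈ weightGE d n) :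
    CoeffIsBigO l (fun i => dilation (t i) (P i)) fun i => t i ^ n * ρ i := fun w => by
  simp only [coeff_dilation]
  rcases lt_or_ge (weight w) n with hw | hw
  · simpa only [hn _ w hw, mul_zero] using isBigO_zero _ l
  · obtain ⟨k, hk⟩ := Nat.exists_eq_add_of_le hw
    simp only [hk, pow_add]
    simpa using ((isBigO_refl (fun i => t i ^ n) l).mul (ht.pow k)).mul (hP w)

theorem CoeffIsBigO.dilation_of_mem_weightLE {P : ι → NCSeries d} {t ρ : ι → ℝ}
    (hP : CoeffIsBigO l P ρ) (ht : (fun _ => (1 : ℝ)) =O[l] t) {n : ℕ}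
    (hn : ∀ i, P i ∈ weightLE d n) :
    CoeffIsBigO l (fun i => dilation (t i) (P i)) fun i => t i ^ n * ρ i := fun w => by
  simp only [coeff_dilation]
  rcases lt_or_ge n (weight w) with hw | hw
  · simpa only [hn _ w hw, mul_zero] using isBigO_zero _ l
  · obtain ⟨k, hk⟩ := Nat.exists_eq_add_of_le hw
    simp only [hk, pow_add]
    simpa using ((isBigO_refl (fun i => t i ^ weight w) l).mul (ht.pow k)).mul (hP w)

variable {N : ℕ} {V : Fin (d + 1) → Euc N → Euc N}

theorem CoeffIsBigO.cNorm_phiField (hV : ∀ i, IsCbSmooth (V i)) {P : ι → NCSeries d} {ρ : ι → ℝ}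
    (hP : CoeffIsBigO l P ρ) {n : ℕ} (hn : ∀ i, P i ∈ weightLE d n)
    (h1 : ∀ i, P i ∈ weightGE d 1) (k : ℕ) :
    (fun i => cNorm k (phiField V (P i))) =O[l] ρ := by
  have hsum : (fun i => ∑ w ∈ (wordsLE d n).erase [],
      |coeff w (P i)| * cNorm k (wordOp V w (id : Euc N → Euc N))) =O[l] ρ :=
    .fun_sum fun w _ => ((hP w).abs_left.const_mul_left _).congr_left fun i => mul_comm _ _
  refine (IsBigO.of_norm_le fun i => ?_).trans hsum
  rw [Real.norm_of_nonneg (cNorm_nonneg _ _)]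
  exact cNorm_phiField_le hV (hn i) (h1 i) k

theorem isBigO_cNorm_phiField_dilation (hV : ∀ i, IsCbSmooth (V i)) {P : ι → NCSeries d}
    {τ : ι → ℝ} (hτ : τ =O[l] fun _ => (1 : ℝ)) (hP : P ∈ coeffBounded d l) {m n : ℕ}
    (hn : ∀ i, P i ∈ weightLE d n) (hm : ∀ i, P i ∈ weightGE d (m + 1)) (k : ℕ) :
    (fun i => cNorm k (phiField V (dilation (τ i) (P i)))) =O[l] fun i => τ i ^ (m + 1) := by
  have hdil := CoeffIsBigO.dilation_of_mem_weightGE hP hτ hm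
  simp only [mul_one] at hdil
  refine hdil.cNorm_phiField hV (fun i => dilation_mem_weightLE (hn i) _) (fun i => ?_) k
  exact dilation_mem_weightGE (weightGE_antitone (Nat.le_add_left 1 m) (hm i)) _

theorem isBigO_phiField_dilation_apply (hV : ∀ i, IsCbSmooth (V i)) {P : ι → NCSeries d}
    {τ : ι → ℝ} (hτ : τ =O[l] fun _ => (1 : ℝ)) (hP : P ∈ coeffBounded d l) {m n : ℕ}
    (hn : ∀ i, P i ∈ weightLE d n) (hm : ∀ i, P i ∈ weightGE d (m + 1)) (x : ι → Euc N) :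
    (fun i => phiField V (dilation (τ i) (P i)) (x i)) =O[l] fun i => τ i ^ (m + 1) := by
  refine (IsBigO.of_norm_le fun i => ?_).trans (isBigO_cNorm_phiField_dilation hV hτ hP hn hm 0)
  refine (isCbSmooth_phiField hV (dilation_mem_weightLE (hn i) _)
    (dilation_mem_weightGE ?_ _)).norm_le_cNorm 0 (x i)
  exact weightGE_antitone (Nat.le_add_left 1 m) (hm i)

theorem isBigO_phiField_flowExp_sub_phiField_sum_divPow (hV : ∀ i, IsCbSmooth (V i)) {τ : ι → ℝ}
    (hτ : τ =O[l] fun _ => (1 : ℝ)) {L Q : ι → NCSeries d} (hL : L ∈ coeffBounded d l)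
    (hQ : Q ∈ coeffBounded d l) (hLlie : ∀ i, L i ∈ lieSeries d) {m : ℕ}
    (hLm : ∀ i, L i ∈ weightLE d m) (hQm : ∀ i, Q i ∈ weightLE d m) (x : ι → Euc N) :
    (fun i => phiField V (dilation (τ i) (Q i)) (flowExp (phiField V (dilation (τ i) (L i))) (x i))
      - phiField V (dilation (τ i) ((∑ k ∈ Finset.range (m + 1), divPow k (L i)) * Q i)) (x i))
      =O[l] fun i => τ i ^ (m + 1) := by
  have hmem (i : ι) : L i ^ (m + 1) * Q i ∈ weightGE d (m + 1) :=
    Ideal.mul_mem_right _ _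
      (pow_mem_weightGE (mem_weightGE_one_of_mem_lieSeries (hLlie i)) (m + 1))
  have hmemLE (i : ι) : L i ^ (m + 1) * Q i ∈ weightLE d ((m + 1) * m + m) :=
    mul_mem_weightLE_add (pow_mem_weightLE (hLm i) _) (hQm i)
  have hremainder := isBigO_cNorm_phiField_dilation hV hτ (mul_mem (pow_mem hL (m + 1)) hQ)
    hmemLE hmem 0
  refine (IsBigO.of_norm_le fun i => ?_).trans hremainder
  have htaylor := norm_phiField_flowExp_sub_le hV (dilation_mem_lieSeries (hLlie i) (τ i))
    (dilation_mem_weightLE (hLm i) (τ i)) (dilation_mem_weightLE (hQm i) (τ i)) (m + 1) (x := x i)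
    (C := cNorm 0 (phiField V (dilation (τ i) (L i ^ (m + 1) * Q i)))) fun y => by
      rw [← map_pow, ← map_mul]
      refine (isCbSmooth_phiField hV (dilation_mem_weightLE (hmemLE i) _)
        (dilation_mem_weightGE ?_ _)).norm_le_cNorm 0 y
      exact weightGE_antitone (Nat.le_add_left 1 m) (hmem i)
  simpa only [divPow, map_mul, map_sum, map_smul, map_pow, Pi.mul_apply, Pi.pow_apply] using htaylor

theorem isBigO_phiField_flowExp_sub (hV : ∀ i, IsCbSmooth (V i)) {τ : ι → ℝ}
    (hτ : τ =O[l] fun _ => (1 : ℝ)) {L Q : ι → NCSeries d} (hL : L ∈ coeffBounded d l)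
    (hQ : Q ∈ coeffBounded d l) (hLlie : ∀ i, L i ∈ lieSeries d) {m : ℕ}
    (hLm : ∀ i, L i ∈ weightLE d m) (hQm : ∀ i, Q i ∈ weightLE d m) (x : ι → Euc N) :
    (fun i => phiField V (dilation (τ i) (Q i)) (flowExp (phiField V (dilation (τ i) (L i))) (x i))
      - phiField V (dilation (τ i) (truncation m (exp (L i) * Q i))) (x i))
      =O[l] fun i => τ i ^ (m + 1) := by
  let taylorSum (i : ι) : NCSeries d := (∑ k ∈ Finset.range (m + 1), divPow k (L i)) * Q i
  let truncated (i : ι) : NCSeries d := truncation m (exp (L i) * Q i)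
  have htaylor : taylorSum ∈ coeffBounded d l := by
    have hsum : (fun i => ∑ k ∈ Finset.range (m + 1), divPow k (L i))
        = ∑ k ∈ Finset.range (m + 1), divPow k L := by
      funext i; rw [Finset.sum_apply]; rfl
    refine (coeffBounded d l).mul_mem ?_ hQ
    exact hsum ▸ sum_mem fun k _ => Subalgebra.smul_mem _ (pow_mem hL k) _
  have htaylorLE (i : ι) : taylorSum i ∈ weightLE d ((m + 1) * m + m) := by
    refine mul_mem_weightLE_add (sum_mem fun k hk => Submodule.smul_mem _ _ ?_) (hQm i)
    exact weightLE_mono (Nat.mul_le_mul_right m (Finset.mem_range.mp hk).le)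
      (pow_mem_weightLE (hLm i) k)
  have htrunc : truncated ∈ coeffBounded d l :=
    truncation_mem_coeffBounded (mul_mem (exp_mem_coeffBounded hL) hQ) m
  have htruncLE (i : ι) : truncated i ∈ weightLE d ((m + 1) * m + m) :=
    weightLE_mono (Nat.le_add_left m _) (truncation_mem_weightLE m _)
  have hdiff (i : ι) : taylorSum i - truncated i ∈ weightGE d (m + 1) := by
    refine SModEq.sub_mem.mp (SModEq.trans ?_ (truncation_smodEq m _).symm)
    exact smodEq_mul
      (exp_smodEq_sum_divPow (mem_weightGE_one_of_mem_lieSeries (hLlie i)) _).symm .rfl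
  have hfields (i : ι) : phiField V (dilation (τ i) ((taylorSum - truncated) i)) (x i)
      = phiField V (dilation (τ i) (taylorSum i)) (x i)
        - phiField V (dilation (τ i) (truncated i)) (x i) := by
    rw [Pi.sub_apply, map_sub]
    exact congrFun (phiOp_sub (dilation_mem_weightLE (htaylorLE i) _)
      (dilation_mem_weightLE (htruncLE i) _) id) (x i)
  refine ((isBigO_phiField_flowExp_sub_phiField_sum_divPow hV hτ hL hQ hLlie hLm hQm x).add
    (isBigO_phiField_dilation_apply hV hτ (sub_mem htaylor htrunc)
      (fun i => sub_mem (htaylorLE i) (htruncLE i)) hdiff x)).congr_left fun i => ?_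
  rw [hfields, sub_add_sub_cancel]

end Asymptotics

/-! ### Compositions of flows and of integration schemes -/

/-- The composition `f_1 ∘ ⋯ ∘ f_n` of a list `[f_1, …, f_n]`. -/
def compList {α : Type*} (fs : List (α → α)) : α → α := fs.foldr (fun f h => f ∘ h) id

@[simp] theorem compList_nil {α : Type*} : compList ([] : List (α → α)) = id := rfl

@[simp] theorem compList_cons {α : Type*} (f : α → α) (fs : List (α → α)) :
    compList (f :: fs) = f ∘ compList fs := rfl

section Schemes

open Asymptotics Filter NCSeries

variable {ι κ : Type*} {l : Filter ι} {N d m : ℕ} {V : Fin (d + 1) → Euc N → Euc N}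

theorem isBigO_phiField_compList_flowExp_sub (hV : ∀ i, IsCbSmooth (V i)) {τ : ι → ℝ}
    (hτ : τ =O[l] fun _ => (1 : ℝ)) {L : κ → ι → NCSeries d} (hL : ∀ j, L j ∈ coeffBounded d l)
    (hLlie : ∀ j i, L j i ∈ lieSeries d) (hLm : ∀ j i, L j i ∈ weightLE d m) (js : List κ)
    {Q : ι → NCSeries d} (hQ : Q ∈ coeffBounded d l) (hQm : ∀ i, Q i ∈ weightLE d m)
    (x : ι → Euc N) :
    (fun i => phiField V (dilation (τ i) (Q i))
        (compList (js.map fun j => flowExp (phiField V (dilation (τ i) (L j i)))) (x i))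
      - phiField V (dilation (τ i)
          (truncation m (expProd (js.reverse.map fun j => L j i) * Q i))) (x i))
      =O[l] fun i => τ i ^ (m + 1) := by
  induction js generalizing Q with
  | nil =>
    refine (isBigO_zero _ l).congr_left fun i => ?_
    simp [truncation_eq_self (hQm i)]
  | cons j js ih =>
    let Q' (i : ι) : NCSeries d := truncation m (exp (L j i) * Q i)
    have hQ' : Q' ∈ coeffBounded d l :=
      truncation_mem_coeffBounded (mul_mem (exp_mem_coeffBounded (hL j)) hQ) m
    have hreorder (i : ι) : truncation m (expProd ((j :: js).reverse.map fun j => L j i) * Q i)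
        = truncation m (expProd (js.reverse.map fun j => L j i) * Q' i) := by
      rw [truncation_eq_truncation_iff, List.reverse_cons, List.map_append, expProd_append,
        mul_assoc]
      refine smodEq_mul .rfl ((truncation_smodEq m _).trans ?_).symm
      simp
    have hstep := isBigO_phiField_flowExp_sub hV hτ (hL j) hQ (hLlie j) (hLm j) hQm fun i =>
      compList (js.map fun j => flowExp (phiField V (dilation (τ i) (L j i)))) (x i)
    refine (hstep.add (ih hQ' fun i => truncation_mem_weightLE m _)).congr_left fun i => ?_
    rw [hreorder, List.map_cons, compList_cons, Function.comp_apply, sub_add_sub_cancel]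

theorem phiField_one : phiField V (1 : NCSeries d) = id := phiOp_one id

/-- Since `exp ∘ log = id`, the flow of `log (exp z_n ⋯ exp z_1)` has the same expansion as the
composition of the flows. -/
theorem isBigO_compList_flowExp_sub_flowExp_log (hV : ∀ i, IsCbSmooth (V i)) {τ : ι → ℝ}
    (hτ : τ =O[l] fun _ => (1 : ℝ)) {z : κ → ι → NCSeries d} (hz : ∀ j, z j ∈ coeffBounded d l)
    (hzlie : ∀ j i, z j i ∈ lieSeries d) (hzm : ∀ j i, z j i ∈ weightLE d m) (js : List κ)
    (x : ι → Euc N) :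
    (fun i => compList (js.map fun j => flowExp (phiField V (dilation (τ i) (z j i)))) (x i)
      - flowExp (phiField V (dilation (τ i)
          (truncation m (log (expProd (js.reverse.map fun j => z j i)))))) (x i))
      =O[l] fun i => τ i ^ (m + 1) := by
  let E (i : ι) : NCSeries d := expProd (js.reverse.map fun j => z j i)
  have hz1 (j : κ) (i : ι) : z j i ∈ weightGE d 1 := mem_weightGE_one_of_mem_lieSeries (hzlie j i)
  have hE1 (i : ι) : E i ≡ 1 [SMOD weightGE d 1] :=
    expProd_smodEq_one (List.forall_mem_map.mpr fun j _ => hz1 j i)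
  have hlogE1 (i : ι) : log (E i) ∈ weightGE d 1 := log_mem_weightGE_one (hE1 i)
  have hlie (i : ι) : truncation m (log (E i)) ∈ lieSeries d := truncation_mem_lieSeries
    (log_expProd_mem_lieSeries (List.forall_mem_map.mpr fun j _ => hzlie j i)) m
  have hexp (i : ι) : truncation m (exp (truncation m (log (E i)))) = truncation m (E i) := by
    have h := (isWeightClosed_weightGE (m + 1)).exp_smodEq_exp
      (mem_weightGE_one_of_mem_lieSeries (hlie i)) (hlogE1 i) (truncation_smodEq m (log (E i)))
    rwa [exp_log (hE1 i), ← truncation_eq_truncation_iff] at h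
  have hbounded : (fun i => truncation m (log (E i))) ∈ coeffBounded d l :=
    truncation_mem_coeffBounded (log_mem_coeffBounded (expProd_mem_coeffBounded hz _)) m
  have hflows := isBigO_phiField_compList_flowExp_sub hV hτ hz hzlie hzm js
    (one_mem _) (fun _ => one_mem_weightLE m) x
  have hflow := isBigO_phiField_flowExp_sub hV hτ hbounded (one_mem _) hlie
    (fun _ => truncation_mem_weightLE m _) (fun _ => one_mem_weightLE m) x
  refine (hflows.sub hflow).congr_left fun i => ?_
  simp only [Pi.one_apply, map_one, mul_one, phiField_one, id_eq, hexp]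
  exact sub_sub_sub_cancel_right _ _ _

section Comparison

variable {g : (Euc N → Euc N) → Euc N → Euc N} {W : ι → Euc N → Euc N} {τ : ι → ℝ}

theorem IsIntegrationScheme.isBigO_sub_flowExp (hg : IsIntegrationScheme m g)
    (hW : ∀ i, IsCbSmooth (W i)) (hWτ : (fun i => cNorm (m + 1) (W i)) =O[l] τ) (x : ι → Euc N) :
    (fun i => g (W i) (x i) - flowExp (W i) (x i)) =O[l] fun i => τ i ^ (m + 1) := by
  obtain ⟨C, -, hC⟩ := hg
  exact (IsBigO.of_norm_le fun i => hC (W i) (hW i) (x i)).trans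
    ((hWτ.pow (m + 1)).const_mul_left C)

theorem isBigO_flowExp_sub_flowExp (hW : ∀ i, IsCbSmooth (W i))
    (hWτ : (fun i => cNorm (m + 1) (W i)) =O[l] fun _ => (1 : ℝ)) (x y : ι → Euc N) :
    (fun i => flowExp (W i) (x i) - flowExp (W i) (y i)) =O[l] fun i => x i - y i := by
  have hexp : (fun i => Real.exp (cNorm 1 (W i))) =O[l] fun _ => (1 : ℝ) := by
    have hbound := (isBigO_one_iff ℝ).mp hWτ
    refine Real.isBigO_exp_comp_one.mpr (hbound.mono_le (.of_forall fun i => ?_))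
    exact (cNorm_mono (Nat.le_add_left 1 m) (W i)).trans (Real.le_norm_self _)
  refine (IsBigO.of_norm_le fun i => (hW i).norm_flowExp_sub_flowExp_le (x i) (y i)).trans ?_
  simpa using hexp.mul (isBigO_refl (fun i => ‖x i - y i‖) l)

theorem isBigO_flowExp_sub_self (hW : ∀ i, IsCbSmooth (W i)) {k : ℕ}
    (hWτ : (fun i => cNorm k (W i)) =O[l] τ) (x : ι → Euc N) :
    (fun i => flowExp (W i) (x i) - x i) =O[l] τ :=
  (IsBigO.of_norm_le fun i => (hW i).norm_flowExp_sub_self_le k (x i)).trans hWτ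

end Comparison

section Composition

variable {g : κ → (Euc N → Euc N) → Euc N → Euc N} {W : κ → ι → Euc N → Euc N} {τ : ι → ℝ}

theorem isBigO_compList_sub_compList_flowExp (hg : ∀ j, IsIntegrationScheme m (g j))
    (hW : ∀ j i, IsCbSmooth (W j i)) (hWτ : ∀ j, (fun i => cNorm (m + 1) (W j i)) =O[l] τ)
    (hτ : τ =O[l] fun _ => (1 : ℝ)) (js : List κ) (x : ι → Euc N) :
    (fun i => compList (js.map fun j => g j (W j i)) (x i)
      - compList (js.map fun j => flowExp (W j i)) (x i)) =O[l] fun i => τ i ^ (m + 1) := by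
  induction js with
  | nil => simpa using isBigO_zero _ l
  | cons j js ih =>
    have hlocal := (hg j).isBigO_sub_flowExp (hW j) (hWτ j) fun i =>
      compList (js.map fun j => g j (W j i)) (x i)
    have hpropagated := (isBigO_flowExp_sub_flowExp (hW j) ((hWτ j).trans hτ) _ _).trans ih
    refine (hlocal.add hpropagated).congr_left fun i => ?_
    simp only [List.map_cons, compList_cons, Function.comp_apply, sub_add_sub_cancel]

theorem isBigO_compList_sub_self (hg : ∀ j, IsIntegrationScheme m (g j))
    (hW : ∀ j i, IsCbSmooth (W j i)) (hWτ : ∀ j, (fun i => cNorm (m + 1) (W j i)) =O[l] τ)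
    (hτ : τ =O[l] fun i => τ i ^ (m + 1)) (js : List κ) (x : ι → Euc N) :
    (fun i => compList (js.map fun j => g j (W j i)) (x i) - x i)
      =O[l] fun i => τ i ^ (m + 1) := by
  induction js with
  | nil => simpa using isBigO_zero _ l
  | cons j js ih =>
    let y (i : ι) : Euc N := compList (js.map fun j => g j (W j i)) (x i)
    have hlocal := (hg j).isBigO_sub_flowExp (hW j) (hWτ j) y
    have hflow := (isBigO_flowExp_sub_self (hW j) (hWτ j) y).trans hτ
    refine ((hlocal.add hflow).add ih).congr_left fun i => ?_
    simp only [List.map_cons, compList_cons, Function.comp_apply, sub_add_sub_cancel, y]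

end Composition

section Error

variable {g : κ → (Euc N → Euc N) → Euc N → Euc N} {z : κ → ι → NCSeries d} {τ : ι → ℝ}

theorem isBigO_compList_sub_flowExp_log_of_bounded (hV : ∀ i, IsCbSmooth (V i))
    (hg : ∀ j, IsIntegrationScheme m (g j)) (hτ : τ =O[l] fun _ => (1 : ℝ))
    (hz : ∀ j, z j ∈ coeffBounded d l) (hzlie : ∀ j i, z j i ∈ lieSeries d)
    (hzm : ∀ j i, z j i ∈ weightLE d m) (js : List κ) (x : ι → Euc N) :
    (fun i => compList (js.map fun j => g j (phiField V (dilation (τ i) (z j i)))) (x i)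
      - flowExp (phiField V (dilation (τ i)
          (truncation m (log (expProd (js.reverse.map fun j => z j i)))))) (x i))
      =O[l] fun i => τ i ^ (m + 1) := by
  have hz1 (j : κ) (i : ι) : z j i ∈ weightGE d 1 := mem_weightGE_one_of_mem_lieSeries (hzlie j i)
  have hfields (j : κ) (i : ι) : IsCbSmooth (phiField V (dilation (τ i) (z j i))) :=
    isCbSmooth_phiField hV (dilation_mem_weightLE (hzm j i) _) (dilation_mem_weightGE (hz1 j i) _)
  have hnorms (j : κ) : (fun i => cNorm (m + 1) (phiField V (dilation (τ i) (z j i)))) =O[l] τ := by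
    simpa using isBigO_cNorm_phiField_dilation (m := 0) hV hτ (hz j) (hzm j) (hz1 j) (m + 1)
  refine ((isBigO_compList_sub_compList_flowExp hg hfields hnorms hτ js x).add
    (isBigO_compList_flowExp_sub_flowExp_log hV hτ hz hzlie hzm js x)).congr_left fun i => ?_
  rw [sub_add_sub_cancel]

theorem isBigO_compList_sub_flowExp_log_of_one_isBigO (hV : ∀ i, IsCbSmooth (V i))
    (hg : ∀ j, IsIntegrationScheme m (g j)) (hτ : (fun _ => (1 : ℝ)) =O[l] τ)
    (hz : ∀ j, z j ∈ coeffBounded d l) (hzlie : ∀ j i, z j i ∈ lieSeries d)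
    (hzm : ∀ j i, z j i ∈ weightLE d m)
    (hnorms : ∀ j, (fun i => cNorm (m + 1) (phiField V (dilation (τ i) (z j i)))) =O[l] τ)
    (js : List κ) (x : ι → Euc N) :
    (fun i => compList (js.map fun j => g j (phiField V (dilation (τ i) (z j i)))) (x i)
      - flowExp (phiField V (dilation (τ i)
          (truncation m (log (expProd (js.reverse.map fun j => z j i)))))) (x i))
      =O[l] fun i => τ i ^ (m + 1) := by
  let L (i : ι) : NCSeries d := truncation m (log (expProd (js.reverse.map fun j => z j i)))
  have hz1 (j : κ) (i : ι) : z j i ∈ weightGE d 1 := mem_weightGE_one_of_mem_lieSeries (hzlie j i)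
  have hL1 (i : ι) : L i ∈ weightGE d 1 := mem_weightGE_one_of_mem_lieSeries <|
    truncation_mem_lieSeries
      (log_expProd_mem_lieSeries (List.forall_mem_map.mpr fun j _ => hzlie j i)) m
  have hLm (i : ι) : L i ∈ weightLE d m := truncation_mem_weightLE m _
  have hL : L ∈ coeffBounded d l :=
    truncation_mem_coeffBounded (log_mem_coeffBounded (expProd_mem_coeffBounded hz _)) m
  have hpow {a b : ℕ} (h : a ≤ b) : (fun i => τ i ^ a) =O[l] fun i => τ i ^ b := by
    obtain ⟨c, rfl⟩ := Nat.exists_eq_add_of_le h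
    simpa [pow_add] using (isBigO_refl (fun i => τ i ^ a) l).mul (hτ.pow c)
  have hcomp := isBigO_compList_sub_self hg
    (fun j i => isCbSmooth_phiField hV (dilation_mem_weightLE (hzm j i) _)
      (dilation_mem_weightGE (hz1 j i) _))
    hnorms (by simpa using hpow (Nat.le_add_left 1 m)) js x
  have hflow := isBigO_flowExp_sub_self
    (fun i => isCbSmooth_phiField hV (dilation_mem_weightLE (hLm i) (τ i))
      (dilation_mem_weightGE (hL1 i) (τ i)))
    ((CoeffIsBigO.dilation_of_mem_weightLE hL hτ hLm).cNorm_phiField hV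
      (fun i => dilation_mem_weightLE (hLm i) _) (fun i => dilation_mem_weightGE (hL1 i) _) 0) x
  simp only [mul_one] at hflow
  exact (hcomp.sub (hflow.trans (hpow m.le_succ))).congr_left
    fun i => sub_sub_sub_cancel_right _ _ _

theorem isBigO_compList_sub_flowExp_log_of_cNorm (hV : ∀ i, IsCbSmooth (V i))
    (hg : ∀ j, IsIntegrationScheme m (g j)) (hz : ∀ j, z j ∈ coeffBounded d l)
    (hzlie : ∀ j i, z j i ∈ lieSeries d) (hzm : ∀ j i, z j i ∈ weightLE d m)
    (hnorms : ∀ j, (fun i => cNorm (m + 1) (phiField V (dilation (τ i) (z j i)))) =O[l] τ)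
    (js : List κ) (x : ι → Euc N) :
    (fun i => compList (js.map fun j => g j (phiField V (dilation (τ i) (z j i)))) (x i)
      - flowExp (phiField V (dilation (τ i)
          (truncation m (log (expProd (js.reverse.map fun j => z j i)))))) (x i))
      =O[l] fun i => τ i ^ (m + 1) := by
  let small : Set ι := {i | ‖τ i‖ ≤ ‖(1 : ℝ)‖}
  have hsmall : τ =O[l ⊓ 𝓟 small] fun _ => (1 : ℝ) :=
    .of_bound' (eventually_inf_principal.mpr (.of_forall fun _ h => h))
  have hlarge : (fun _ => (1 : ℝ)) =O[l ⊓ 𝓟 smallᶜ] τ :=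
    .of_bound' (eventually_inf_principal.mpr (.of_forall fun _ h => le_of_not_ge h))
  have hzsub {s : Set ι} (j : κ) : z j ∈ coeffBounded d (l ⊓ 𝓟 s) := fun w =>
    (hz j w).mono inf_le_left
  have hcover : l = l ⊓ 𝓟 small ⊔ l ⊓ 𝓟 smallᶜ := by
    rw [← inf_sup_left, sup_principal, Set.union_compl_self, principal_univ, inf_top_eq]
  refine IsBigO.mono (IsBigO.sup ?_ ?_) hcover.le
  · exact isBigO_compList_sub_flowExp_log_of_bounded hV hg hsmall hzsub hzlie hzm js x
  · exact isBigO_compList_sub_flowExp_log_of_one_isBigO hV hg hlarge hzsub hzlie hzm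
      (fun j => (hnorms j).mono inf_le_left) js x

/-- Rescaling by `1 / R` reduces coefficients of size `R` to bounded ones; the scale `R` is absorbed
into the dilation parameter. -/
theorem isBigO_compList_sub_flowExp_log (hV : ∀ i, IsCbSmooth (V i))
    (hg : ∀ j, IsIntegrationScheme m (g j)) {t R : ι → ℝ} (ht : t =O[l] fun _ => (1 : ℝ))
    (hR : ∀ i, 1 ≤ R i) (hz : ∀ j, CoeffIsBigO l (z j) R) (hzlie : ∀ j i, z j i ∈ lieSeries d)
    (hzm : ∀ j i, z j i ∈ weightLE d m) (js : List κ) (x : ι → Euc N) :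
    (fun i => compList (js.map fun j => g j (phiField V (dilation (t i) (z j i)))) (x i)
      - flowExp (phiField V (dilation (t i)
          (truncation m (log (expProd (js.reverse.map fun j => z j i)))))) (x i))
      =O[l] fun i => (t i * R i) ^ (m + 1) := by
  let τ (i : ι) : ℝ := t i * R i
  let z' (j : κ) (i : ι) : NCSeries d := dilation (R i)⁻¹ (z j i)
  have hR0 (i : ι) : R i ≠ 0 := (zero_lt_one.trans_le (hR i)).ne'
  have hRinv : (fun i => (R i)⁻¹) =O[l] fun _ => (1 : ℝ) := .of_norm_le fun i => by
    rw [Real.norm_of_nonneg (inv_nonneg.mpr (zero_le_one.trans (hR i)))]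
    exact inv_le_one_of_one_le₀ (hR i)
  have hz1 (j : κ) (i : ι) : z j i ∈ weightGE d 1 := mem_weightGE_one_of_mem_lieSeries (hzlie j i)
  have hz' (j : κ) : z' j ∈ coeffBounded d l := fun w => by
    simpa only [pow_one, inv_mul_cancel₀ (hR0 _)] using
      (hz j).dilation_of_mem_weightGE hRinv (hz1 j) w
  have hdil (i : ι) (P : NCSeries d) : dilation (τ i) (dilation (R i)⁻¹ P) = dilation (t i) P := by
    rw [dilation_dilation, mul_inv_cancel_right₀ (hR0 i)]
  have hnorms (j : κ) :
      (fun i => cNorm (m + 1) (phiField V (dilation (τ i) (z' j i)))) =O[l] τ := by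
    simpa only [pow_one, z', hdil] using ((hz j).dilation_of_mem_weightGE ht (hz1 j)).cNorm_phiField
      hV (fun i => dilation_mem_weightLE (hzm j i) _) (fun i => dilation_mem_weightGE (hz1 j i) _) _
  have hlog (i : ι) : dilation (τ i) (truncation m (log (expProd (js.reverse.map fun j => z' j i))))
      = dilation (t i) (truncation m (log (expProd (js.reverse.map fun j => z j i)))) := by
    rw [← hdil, dilation_truncation (R i)⁻¹, dilation_log, dilation_expProd, List.map_map]
    rfl
  have hscaled :
      (fun i => compList (js.map fun j => g j (phiField V (dilation (τ i) (z' j i)))) (x i)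
      - flowExp (phiField V (dilation (τ i)
          (truncation m (log (expProd (js.reverse.map fun j => z' j i)))))) (x i))
      =O[l] fun i => τ i ^ (m + 1) :=
    isBigO_compList_sub_flowExp_log_of_cNorm hV hg hz'
      (fun j i => dilation_mem_lieSeries (hzlie j i) _)
      (fun j i => dilation_mem_weightLE (hzm j i) _) hnorms js x
  simpa only [z', hdil, hlog] using hscaled

end Error

end Schemes

/-! ### Replacing Lie polynomials by bounded ones with the same fields -/

theorem exists_finset_linear_reconstruction {K ι E F : Type*} [Field K] [AddCommGroup E]
    [Module K E] [FiniteDimensional K E] [AddCommGroup F] [Module K F] (ℓ : ι → E →ₗ[K] F) :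
    ∃ (A : Finset ι) (r : (A → F) →ₗ[K] E), ∀ j z, ℓ j (r fun α => ℓ α z) = ℓ j z := by
  obtain ⟨A, hA⟩ := Finset.exists_inf_le fun j => LinearMap.ker (ℓ j)
  let T : E →ₗ[K] (A → F) := LinearMap.pi fun α => ℓ α
  obtain ⟨r₀, hr₀⟩ := T.rangeRestrict.exists_rightInverse_of_surjective T.range_rangeRestrict
  obtain ⟨r, hr⟩ := LinearMap.exists_extend r₀
  refine ⟨A, r, fun j z => ?_⟩
  have hT : T (r (T z)) = T z := by
    have hrT : r (T z) = r₀ (T.rangeRestrict z) := LinearMap.congr_fun hr (T.rangeRestrict z)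
    rw [hrT]
    exact congrArg Subtype.val (LinearMap.congr_fun hr₀ (T.rangeRestrict z))
  have hker : r (T z) - z ∈ A.inf fun j => LinearMap.ker (ℓ j) := by
    rw [Submodule.mem_finsetInf]
    intro α hα
    rw [LinearMap.sub_mem_ker_iff]
    exact congrFun hT ⟨α, hα⟩
  exact LinearMap.sub_mem_ker_iff.mp (hA j hker)

section Representative

open Asymptotics NCSeries

variable {N d : ℕ}

instance (d m : ℕ) : FiniteDimensional ℝ (weightLE d m) := by
  let T : weightLE d m →ₗ[ℝ] (wordsLE d m → ℝ) :=
    LinearMap.pi fun w => (coeff w.1).comp (weightLE d m).subtype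
  refine Module.Finite.of_injective T ((injective_iff_map_eq_zero T).mpr fun P hP => ?_)
  ext w
  rcases le_or_gt (weight w) m with hw | hw
  · exact congrFun hP ⟨w, mem_wordsLE.mpr hw⟩
  · exact P.2 w hw

/-- The space of Lie series without components of weight larger than `m`. -/
def truncatedLieSeries (d m : ℕ) : Submodule ℝ (NCSeries d) :=
  (lieSeries d).toSubmodule ⊓ weightLE d m

instance (d m : ℕ) : FiniteDimensional ℝ (truncatedLieSeries d m) :=
  Submodule.finiteDimensional_inf_right _ _

theorem exists_finset_representative (V : Fin (d + 1) → Euc N → Euc N) (m : ℕ) (S : Set ℝ) :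
    ∃ (A : Finset (S × Euc N)) (r : (A → Euc N) →ₗ[ℝ] truncatedLieSeries d m),
      ∀ P ∈ truncatedLieSeries d m, ∀ t ∈ S,
        phiField V (dilation t (r fun α => phiField V (dilation α.1.1 P) α.1.2 : NCSeries d))
          = phiField V (dilation t P) := by
  let ℓ (α : S × Euc N) : truncatedLieSeries d m →ₗ[ℝ] Euc N :=
    (LinearMap.proj α.2).comp ((phiOpTruncated V m id).comp
      ((dilation (α.1 : ℝ)).toLinearMap.comp (truncatedLieSeries d m).subtype))
  have hℓ (α : S × Euc N) (P : truncatedLieSeries d m) :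
      ℓ α P = phiField V (dilation α.1 (P : NCSeries d)) α.2 :=
    (congrFun (phiOp_eq_phiOpTruncated (dilation_mem_weightLE P.2.2 _) id) α.2).symm
  obtain ⟨A, r, hr⟩ := exists_finset_linear_reconstruction ℓ
  refine ⟨A, r, fun P hP t ht => funext fun x => ?_⟩
  simpa only [hℓ] using hr (⟨t, ht⟩, x) ⟨P, hP⟩

theorem coeffIsBigO_linearMap {ι E : Type*} [NormedAddCommGroup E] [NormedSpace ℝ E]
    [FiniteDimensional ℝ E] {W : Submodule ℝ (NCSeries d)} (r : E →ₗ[ℝ] W) (l : Filter ι)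
    (y : ι → E) : CoeffIsBigO l (fun i => (r (y i) : NCSeries d)) fun i => ‖y i‖ := fun w =>
  (((coeff w).comp (W.subtype.comp r)).toContinuousLinearMap.isBigO_comp y l).norm_right

theorem sModEq_nullIdeal_of_phiField_dilation_eq {V : Fin (d + 1) → Euc N → Euc N}
    (hV : ∀ i, ContDiff ℝ ∞ (V i)) {m : ℕ} {P Q : NCSeries d} (hP : P ∈ truncatedLieSeries d m)
    (hQ : Q ∈ truncatedLieSeries d m) {S : Set ℝ} (hS : S.Infinite)
    (h : ∀ t ∈ S, phiField V (dilation t P) = phiField V (dilation t Q)) :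
    P ≡ Q [SMOD nullIdeal V hV] := by
  have hsub := sub_mem hP hQ
  refine SModEq.sub_mem.mpr
    (mem_nullIdeal_of_phiField_dilation_eq_zero (hV := hV) hsub.1 hsub.2 hS fun t ht => ?_)
  rw [map_sub]
  exact (phiOp_sub (dilation_mem_weightLE hP.2 t) (dilation_mem_weightLE hQ.2 t) id).trans
    (sub_eq_zero.mpr (h t ht))

theorem phiField_dilation_truncation_log_expProd_eq {V : Fin (d + 1) → Euc N → Euc N}
    (hV : ∀ i, ContDiff ℝ ∞ (V i)) {κ : Type*} {m : ℕ} {z z' : κ → NCSeries d}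
    (hz : ∀ j, z j ∈ truncatedLieSeries d m) (hz' : ∀ j, z' j ∈ truncatedLieSeries d m)
    {S : Set ℝ} (hS : S.Infinite)
    (h : ∀ j, ∀ t ∈ S, phiField V (dilation t (z j)) = phiField V (dilation t (z' j)))
    (js : List κ) (t : ℝ) :
    phiField V (dilation t (truncation m (log (expProd (js.map z)))))
      = phiField V (dilation t (truncation m (log (expProd (js.map z'))))) := by
  have hI := isWeightClosed_nullIdeal (hV := hV)
  have hpos {y : κ → NCSeries d} (hy : ∀ j, y j ∈ truncatedLieSeries d m) (j : κ) :
      y j ∈ weightGE d 1 := mem_weightGE_one_of_mem_lieSeries (hy j).1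
  have hone {y : κ → NCSeries d} (hy : ∀ j, y j ∈ truncatedLieSeries d m) :
      expProd (js.map y) ≡ 1 [SMOD weightGE d 1] :=
    expProd_smodEq_one (List.forall_mem_map.mpr fun j _ => hpos hy j)
  exact phiField_dilation_truncation_eq (hI.log_smodEq_log (hone hz) (hone hz')
    (hI.expProd_smodEq_expProd (hpos hz) (hpos hz')
      (fun j => sModEq_nullIdeal_of_phiField_dilation_eq hV (hz j) (hz' j) hS (h j)) js)) m t

theorem exists_norm_compList_sub_flowExp_log_le {κ : Type*} [Fintype κ]
    {V : Fin (d + 1) → Euc N → Euc N} (hV : ∀ i, IsCbSmooth (V i)) {m : ℕ}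
    {g : κ → (Euc N → Euc N) → Euc N → Euc N} (hg : ∀ j, IsIntegrationScheme m (g j))
    (js : List κ) :
    ∃ (A : Finset (Set.Ioc (0 : ℝ) 1 × Euc N)) (C : ℝ),
      ∀ z : κ → NCSeries d, (∀ j, z j ∈ truncatedLieSeries d m) → ∀ t ∈ Set.Ioc (0 : ℝ) 1, ∀ x,
      ‖compList (js.map fun j => g j (phiField V (dilation t (z j)))) x
        - flowExp (phiField V (dilation t
            (truncation m (log (expProd (js.reverse.map z)))))) x‖
        ≤ C * (t * (1 + ∑ j, ‖fun α : A => phiField V (dilation α.1.1 (z j)) α.1.2‖))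
            ^ (m + 1) := by
  obtain ⟨A, r, hr⟩ := exists_finset_representative V m (Set.Ioc 0 1)
  let ι := (κ → truncatedLieSeries d m) × Set.Ioc (0 : ℝ) 1 × Euc N
  let y (j : κ) (i : ι) (α : A) : Euc N := phiField V (dilation α.1.1 (i.1 j : NCSeries d)) α.1.2
  let R (i : ι) : ℝ := 1 + ∑ j, ‖y j i‖
  have hR (i : ι) : 1 ≤ R i :=
    le_add_of_nonneg_right (Finset.sum_nonneg fun _ _ => norm_nonneg _)
  have hyR (j : κ) : (fun i => ‖y j i‖) =O[⊤] R := .of_norm_le fun i => by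
    rw [norm_norm]
    exact (Finset.single_le_sum (fun j _ => norm_nonneg (y j i)) (Finset.mem_univ j)).trans
      (le_add_of_nonneg_left zero_le_one)
  have ht : (fun i : ι => (i.2.1 : ℝ)) =O[⊤] fun _ => (1 : ℝ) := .of_norm_le fun i => by
    rw [Real.norm_of_nonneg i.2.1.2.1.le]
    exact i.2.1.2.2
  obtain ⟨C, hC⟩ := isBigO_top.mp (isBigO_compList_sub_flowExp_log hV hg ht hR
    (fun j w => (coeffIsBigO_linearMap r ⊤ (y j) w).trans (hyR j))
    (fun j i => (r (y j i)).2.1) (fun j i => (r (y j i)).2.2) js fun i => i.2.2)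
  refine ⟨A, C, fun z hz t ht x => ?_⟩
  let i : ι := (fun j => ⟨z j, hz j⟩, ⟨t, ht⟩, x)
  have hfield (j : κ) : ∀ u ∈ Set.Ioc (0 : ℝ) 1,
      phiField V (dilation u (r (y j i) : NCSeries d)) = phiField V (dilation u (z j)) :=
    hr (z j) (hz j)
  have hnonneg : 0 ≤ t * R i := mul_nonneg ht.1.le (zero_le_one.trans (hR i))
  rw [← phiField_dilation_truncation_log_expProd_eq (fun j => (hV j).1) (fun j => (r (y j i)).2) hz
    (Set.Ioc_infinite one_pos) hfield]
  simp only [← hfield _ t ht]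
  exact (hC i).trans_eq (congrArg (C * ·) (Real.norm_of_nonneg (pow_nonneg hnonneg _)))

end Representative

section Original

open NCSeries

variable {N d : ℕ} {V : Fin (d + 1) → Euc N → Euc N}

theorem phiField_rescale_sq {t : ℝ} (ht : 0 ≤ t) (P : Series d) :
    phiField V (rescale (t ^ 2) P) = phiField V (dilation t (ofSeries P)) := by
  have hrescale := ofSeries_rescale (sq_nonneg t) (ofSeries P)
  rw [Real.sqrt_sq ht] at hrescale
  exact congrArg (phiField V) hrescale

theorem ofSeries_mem_truncatedLieSeries {m : ℕ} {P : Series d} (hP : IsLieSeries P)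
    (hPm : P = trunc m P) : ofSeries P ∈ truncatedLieSeries d m := by
  refine ⟨isLieSeries_iff.mp hP, ?_⟩
  rw [hPm]
  exact (ofSeries_trunc m P).symm ▸ truncation_mem_weightLE m P

theorem exists_norm_compAll_sub_flowExp_bch_le (hV : ∀ i, IsCbSmooth (V i)) {m M : ℕ}
    {g : Fin M → (Euc N → Euc N) → Euc N → Euc N} (hg : ∀ j, IsIntegrationScheme m (g j)) :
    ∃ (A : Finset (Set.Ioc (0 : ℝ) 1 × Euc N)) (C : ℝ), ∀ z : Fin M → Series d,
      (∀ j, IsLieSeries (z j)) → (∀ j, z j = trunc m (z j)) → ∀ s : ℝ, 0 < s → s ≤ 1 → ∀ x,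
      ‖compAll (fun j => g j (phiField V (rescale s (z j)))) x
        - flowExp (phiField V (rescale s (trunc m (bch (List.ofFn z).reverse)))) x‖
        ≤ s ^ (((m : ℝ) + 1) / 2) * (C *
          (1 + ∑ j, ‖fun α : A => phiField V (rescale (α.1.1 ^ 2) (z j)) α.1.2‖) ^ (m + 1)) := by
  obtain ⟨A, C, hC⟩ := exists_norm_compList_sub_flowExp_log_le hV hg (List.finRange M)
  refine ⟨A, C, fun z hz hzm s hs hs1 x => ?_⟩
  have hpow : s ^ (((m : ℝ) + 1) / 2) = √s ^ (m + 1) := by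
    rw [Real.sqrt_eq_rpow, ← Real.rpow_mul_natCast hs.le]
    push_cast
    ring_nf
  have hbch : ofSeries (trunc m (bch (List.ofFn z).reverse))
      = truncation m (log (expProd ((List.finRange M).reverse.map fun j => ofSeries (z j)))) := by
    rw [List.ofFn_eq_map, ← List.map_reverse]
    refine (ofSeries_trunc m _).trans (congrArg (truncation m) ((ofSeries_bch _).trans ?_))
    rw [List.map_map]
    rfl
  have hbound := hC (fun j => ofSeries (z j))
    (fun j => ofSeries_mem_truncatedLieSeries (hz j) (hzm j)) √s
    ⟨Real.sqrt_pos.mpr hs, Real.sqrt_le_one.mpr hs1⟩ x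
  have hrescale (α : A) (j : Fin M) :=
    phiField_rescale_sq (V := V) α.1.1.2.1.le (z j)
  simp only [← hbch, ← phiField_rescale_sq (Real.sqrt_nonneg s), Real.sq_sqrt hs.le,
    ← List.ofFn_eq_map, ← hrescale] at hbound
  rw [hpow, mul_left_comm, ← mul_pow]
  exact hbound

end Original

/-! ### Moments -/

section Moments

theorem outerLpNorm_le_eLpNorm {Ω : Type*} [MeasurableSpace Ω] {μ : Measure Ω} {f h : Ω → ℝ≥0∞}
    (hh : AEMeasurable h μ) (hfh : ∀ x, f x ≤ h x) (p : ℝ) :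
    outerLpNorm f p μ ≤ eLpNorm h (ENNReal.ofReal p) μ := by
  classical
  obtain ⟨S, hS, hSmeas, hS0⟩ := exists_measurable_superset_of_null hh.ae_eq_mk
  let G : Ω → ℝ≥0∞ := S.piecewise ⊤ (hh.mk h)
  have hG : Measurable G := .piecewise hSmeas measurable_const hh.measurable_mk
  have hfG (x : Ω) : f x ≤ G x := by
    by_cases hx : x ∈ S
    · simp [G, hx]
    · have hmk : h x = hh.mk h x := not_not.mp fun hne => hx (hS hne)
      simpa [G, hx, ← hmk] using hfh x
  have hGh : G =ᵐ[μ] h := by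
    filter_upwards [measure_eq_zero_iff_ae_notMem.mp hS0, hh.ae_eq_mk] with x hx hmk
    simp [G, hx, hmk]
  exact (iInf₂_le_of_le G hG (iInf_le _ hfG)).trans_eq (eLpNorm_congr_ae hGh)

theorem memLp_of_integrable_exp {Ω : Type*} [MeasurableSpace Ω] {μ : Measure Ω} {Y : Ω → ℝ}
    (hY : ∀ x, 0 ≤ Y x) (h : Integrable (fun x => Real.exp (Y x)) μ) {q : ℝ≥0∞} (hq : q ≠ ⊤) :
    MemLp Y q μ := by
  have hYmeas : AEMeasurable Y μ := by
    simpa [Function.comp_def] using Real.measurable_log.comp_aemeasurable h.aemeasurable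
  have hneg : Integrable (fun x => Real.exp (-1 * Y x)) μ :=
    h.mono' (by fun_prop) (.of_forall fun x => by
      rw [Real.norm_of_nonneg (Real.exp_pos _).le, Real.exp_le_exp]
      linarith [hY x])
  rcases eq_or_ne q 0 with rfl | hq0
  · exact memLp_zero_iff_aestronglyMeasurable.mpr hYmeas.aestronglyMeasurable
  rw [← integrable_norm_rpow_iff hYmeas.aestronglyMeasurable hq0 hq]
  exact ProbabilityTheory.integrable_rpow_abs_of_integrable_exp_mul one_ne_zero
    (by simpa only [one_mul] using h) hneg ENNReal.toReal_nonneg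

theorem memLp_norm_pow {Ω E : Type*} [MeasurableSpace Ω] {μ : Measure Ω} [NormedAddCommGroup E]
    {f : Ω → E} {p : ℝ≥0∞} {n : ℕ} (hn : n ≠ 0) (hf : MemLp f (p * n) μ) :
    MemLp (fun x => ‖f x‖ ^ n) p μ := by
  simpa [ENNReal.mul_div_cancel_right (Nat.cast_ne_zero.mpr hn) (ENNReal.natCast_ne_top n)]
    using hf.norm_rpow_div n

theorem memLp_one_add_sum_norm_pow {Ω κ ι E : Type*} [MeasurableSpace Ω] {μ : Measure Ω}
    [IsFiniteMeasure μ] [Fintype κ] [Fintype ι] [NormedAddCommGroup E]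
    {f : κ → Ω → ι → E} {p : ℝ≥0∞} {n : ℕ} (hn : n ≠ 0)
    (hf : ∀ j i, MemLp (fun x => f j x i) (p * n) μ) :
    MemLp (fun x => (1 + ∑ j, ‖f j x‖) ^ n) p μ := by
  have hsum : MemLp (fun x => ∑ j, ‖f j x‖) (p * n) μ :=
    memLp_finsetSum _ fun j _ => MemLp.norm (.of_eval (hf j))
  have hnonneg (x : Ω) : 0 ≤ 1 + ∑ j, ‖f j x‖ :=
    add_nonneg zero_le_one (Finset.sum_nonneg fun _ _ => norm_nonneg _)
  simpa only [Pi.add_apply, Real.norm_of_nonneg (hnonneg _)] using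
    memLp_norm_pow hn ((memLp_const (1 : ℝ)).add hsum)

theorem outerLpNorm_iSup_enorm_le {Ω X E : Type*} [MeasurableSpace Ω] {μ : Measure Ω}
    [NormedAddCommGroup E] {f : Ω → X → E} {h : Ω → ℝ} {p c : ℝ}
    (hh : MemLp h (ENNReal.ofReal p) μ) (hc : 0 ≤ c) (hf : ∀ x y, ‖f x y‖ ≤ c * h x) :
    outerLpNorm (fun x => ⨆ y, ‖f x y‖ₑ) p μ
      ≤ ENNReal.ofReal ((eLpNorm h (ENNReal.ofReal p) μ).toReal * c) := by
  have hmeas : AEMeasurable (fun x => ‖(c • h) x‖ₑ) μ := (hh.1.const_smul c).enorm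
  refine (outerLpNorm_le_eLpNorm hmeas (fun x => iSup_le fun y => ?_) p).trans_eq ?_
  · exact enorm_le_iff_norm_le.mpr ((hf x y).trans (le_abs_self _))
  · rw [eLpNorm_enorm, eLpNorm_const_smul, Real.enorm_of_nonneg hc, mul_comm,
      ENNReal.ofReal_mul ENNReal.toReal_nonneg, ENNReal.ofReal_toReal hh.2.ne]

theorem memLp_apply_of_integrable_exp_cNorm {Ω κ : Type*} [MeasurableSpace Ω] {μ : Measure Ω}
    [Fintype κ] {N n : ℕ} {W : κ → Ω → Euc N → Euc N} (hW : ∀ j a, IsCbSmooth (W j a))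
    {j : κ} {x : Euc N} (hmeas : AEStronglyMeasurable (fun a => W j a x) μ)
    (hexp : Integrable (fun a => Real.exp (∑ j, cNorm n (W j a))) μ) {q : ℝ≥0∞} (hq : q ≠ ⊤) :
    MemLp (fun a => W j a x) q μ := by
  have hnonneg (j : κ) (a : Ω) : 0 ≤ cNorm n (W j a) := cNorm_nonneg n (W j a)
  refine (memLp_of_integrable_exp (fun a => Finset.sum_nonneg fun j _ => hnonneg j a) hexp hq).mono
    hmeas (.of_forall fun a => ?_)
  exact ((hW j a).norm_le_cNorm n x).trans
    ((Finset.single_le_sum (fun j _ => hnonneg j a) (Finset.mem_univ j)).trans (le_abs_self _))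

theorem measurable_phiField_apply {Ω : Type*} [MeasurableSpace Ω] {N d m : ℕ}
    (V : Fin (d + 1) → Euc N → Euc N) {P : Ω → NCSeries d}
    (hP : ∀ w, Measurable fun a => NCSeries.coeff w (P a))
    (hPm : ∀ a, P a ∈ NCSeries.weightLE d m) (x : Euc N) :
    Measurable fun a => phiField V (P a) x := by
  have hsum (a : Ω) : phiField V (P a) x
      = ∑ w ∈ wordsLE d m, NCSeries.coeff w (P a) • wordOp V w id x := by
    refine (congrFun ((phiOp_eq_phiOpTruncated (hPm a) id).trans
      (phiOpTruncated_apply m id (P a))) x).trans ?_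
    simp
  simp only [hsum]
  exact Finset.measurable_fun_sum _ fun w _ => (hP w).smul_const _

theorem memLp_phiField_rescale {Ω κ : Type*} [MeasurableSpace Ω] {μ : Measure Ω} [Fintype κ]
    {N d m n : ℕ} {V : Fin (d + 1) → Euc N → Euc N} (hV : ∀ i, IsCbSmooth (V i))
    {Z : κ → Ω → Series d} (hZmeas : ∀ j, Measurable (Z j)) (hZlie : ∀ j a, IsLieSeries (Z j a))
    (hZtrunc : ∀ j a, Z j a = trunc m (Z j a)) {s : ℝ} (hs : 0 ≤ s)
    (hexp : Integrable (fun a => Real.exp (∑ j, cNorm n (phiField V (rescale s (Z j a))))) μ)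
    {q : ℝ≥0∞} (hq : q ≠ ⊤) (j : κ) (x : Euc N) :
    MemLp (fun a => phiField V (rescale s (Z j a)) x) q μ := by
  have hmem (j : κ) (a : Ω) := ofSeries_mem_truncatedLieSeries (hZlie j a) (hZtrunc j a)
  have hLE (j : κ) (a : Ω) : NCSeries.dilation √s (NCSeries.ofSeries (Z j a)) ∈
      NCSeries.weightLE d m := NCSeries.dilation_mem_weightLE (hmem j a).2 _
  have hrescale (j : κ) (a : Ω) : phiField V (rescale s (Z j a))
      = phiField V (NCSeries.dilation √s (NCSeries.ofSeries (Z j a))) :=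
    congrArg (phiField V) (NCSeries.ofSeries_rescale hs _)
  simp only [hrescale] at hexp ⊢
  refine memLp_apply_of_integrable_exp_cNorm (n := n) (fun j a => isCbSmooth_phiField hV (hLE j a)
    (NCSeries.dilation_mem_weightGE
      (NCSeries.mem_weightGE_one_of_mem_lieSeries (hmem j a).1) _)) ?_ hexp hq
  refine (measurable_phiField_apply V (fun w => ?_) (hLE j) x).aestronglyMeasurable
  simp only [NCSeries.coeff_dilation]
  exact ((measurable_pi_apply w).comp (hZmeas j)).const_mul _

end Moments

end

end KRK

theorem theorem1_general
    {Ω : Type*} [MeasurableSpace Ω] (μ : Measure Ω) [IsFiniteMeasure μ]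
    (N d m M : ℕ)
    (V : Fin (d + 1) → EuclideanSpace ℝ (Fin N) → EuclideanSpace ℝ (Fin N))
    (hV : ∀ i, IsCbSmooth (V i))
    (Z : Fin M → Ω → Series d)
    (hZlie : ∀ i ω, IsLieSeries (Z i ω))
    (hZtrunc : ∀ i ω, Z i ω = trunc m (Z i ω))
    (p : ℝ) (hp : 0 < p)
    (hZ : ∀ s : ℝ, 0 < s → s ≤ 1 → ∀ j x,
      MemLp (fun ω => phiField V (rescale s (Z j ω)) x) (ENNReal.ofReal (p * (m + 1))) μ)
    (g : Fin M → (EuclideanSpace ℝ (Fin N) → EuclideanSpace ℝ (Fin N)) →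
      EuclideanSpace ℝ (Fin N) → EuclideanSpace ℝ (Fin N))
    (hg : ∀ i, IsIntegrationScheme m (g i)) :
    ∃ C : ℝ, 0 < C ∧ ∀ s : ℝ, 0 < s → s ≤ 1 →
      outerLpNorm
        (fun ω => ⨆ x : EuclideanSpace ℝ (Fin N),
          ‖compAll (fun i => g i (phiField V (rescale s (Z i ω)))) x
            - flowExp (phiField V (rescale s
                (trunc m (bch (List.ofFn fun i => Z i ω).reverse)))) x‖ₑ)
        p μ
      ≤ ENNReal.ofReal (C * s ^ (((m : ℝ) + 1) / 2)) := by
  obtain ⟨A, C, hC⟩ := exists_norm_compAll_sub_flowExp_bch_le hV hg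
  let R (ω : Ω) : ℝ :=
    (1 + ∑ j, ‖fun α : A => phiField V (rescale (α.1.1 ^ 2) (Z j ω)) α.1.2‖) ^ (m + 1)
  have hR : MemLp (fun ω => C * R ω) (ENNReal.ofReal p) μ := by
    refine (memLp_one_add_sum_norm_pow m.succ_ne_zero fun j α => ?_).const_mul C
    rw [← ENNReal.ofReal_natCast, ← ENNReal.ofReal_mul hp.le, Nat.cast_add_one]
    exact hZ _ (pow_pos α.1.1.2.1 2) (pow_le_one₀ α.1.1.2.1.le α.1.1.2.2) j α.1.2
  refine ⟨(eLpNorm (fun ω => C * R ω) (ENNReal.ofReal p) μ).toReal + 1, by positivity,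
    fun s hs hs1 => ?_⟩
  have hs0 : 0 ≤ s ^ (((m : ℝ) + 1) / 2) := Real.rpow_nonneg hs.le _
  refine (outerLpNorm_iSup_enorm_le hR hs0 fun ω x =>
    hC (fun i => Z i ω) (hZlie · ω) (hZtrunc · ω) s hs hs1 x).trans ?_
  gcongr
  exact le_add_of_nonneg_right zero_le_one

theorem theorem1
    {Ω : Type*} [MeasurableSpace Ω] (μ : Measure Ω) [IsProbabilityMeasure μ]
    (N d m M : ℕ) (hm : 1 ≤ m) (hM : 2 ≤ M)
    (V : Fin (d + 1) → EuclideanSpace ℝ (Fin N) → EuclideanSpace ℝ (Fin N))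
    (hV : ∀ i, IsCbSmooth (V i))
    (Z : Fin M → Ω → Series d)
    (hZmeas : ∀ i, Measurable (Z i))
    (hZlie : ∀ i ω, IsLieSeries (Z i ω))
    (hZtrunc : ∀ i ω, Z i ω = trunc m (Z i ω))
    (hZint : ∀ i, Integrable (fun ω => l2Norm (trunc m (Z i ω))) μ)
    (hZexp : ∀ s : ℝ, 0 < s → s ≤ 1 → ∀ a : ℝ, 0 < a →
      Integrable (fun ω =>
        Real.exp (a * ∑ j, cNorm (m + 1) (phiField V (rescale s (Z j ω))))) μ)
    (p : ℝ) (hp : 1 ≤ p)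
    (g : Fin M → (EuclideanSpace ℝ (Fin N) → EuclideanSpace ℝ (Fin N)) →
      EuclideanSpace ℝ (Fin N) → EuclideanSpace ℝ (Fin N))
    (hg : ∀ i, IsIntegrationScheme m (g i)) :
    ∃ C : ℝ, 0 < C ∧ ∀ s : ℝ, 0 < s → s ≤ 1 →
      outerLpNorm
        (fun ω => ⨆ x : EuclideanSpace ℝ (Fin N),
          ‖compAll (fun i => g i (phiField V (rescale s (Z i ω)))) x
            - flowExp (phiField V (rescale s
                (trunc m (bch (List.ofFn fun i => Z i ω).reverse)))) x‖ₑ)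
        p μ
      ≤ ENNReal.ofReal (C * s ^ (((m : ℝ) + 1) / 2)) :=
  theorem1_general μ N d m M V hV Z hZlie hZtrunc p (zero_lt_one.trans_le hp) (fun s hs hs1 =>
    memLp_phiField_rescale hV hZmeas hZlie hZtrunc hs.le
      (by simpa only [one_mul] using hZexp s hs hs1 1 one_pos) ENNReal.ofReal_ne_top) g hg
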